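/- Let $C$ be a finite set of $m$ candidates and consider $n$ voters. A partial profile $\mathbf P=(P_1,\dots,P_n)$ consists of $n$ partial orders on $C$; a completion of $\mathbf P$ is a profile $\mathbf T=(T_1,\dots,T_n)$ of linear orders on $C$ in which each $T_i$ is a linear extension of $P_i$. Under the plurality rule a voter gives score $1$ to the candidate ranked first and $0$ to all others (score vector $(1,0,\dots,0)$); under the veto rule a voter gives score $0$ to the candidate ranked last and $1$ to all others (score vector $(1,\dots,1,0)$). The score $s(\mathbf T,c)$ of a candidate $c$ is the sum of the scores that the voters give to $c$. Given a linear order $\succ$ on $C$ (the tie breaker), sort the candidates by decreasing score, and break ties between equal scores by $\succ$; $c$ is a top-$k$ winner of $\mathbf T$ if its position in the resulting linear order is at most $k$, and $c$ is a possible top-$k$ winner of $\mathbf P$ if it is a top-$k$ winner of at least one completion of $\mathbf P$. **Theorem.** For every fixed $k$, the following problem is solvable in polynomial time under the plurality rule, and also under the veto rule: given a candidate set $C$, a partial profile $\mathbf P$ over $C$, a tie breaker $\succ$ on $C$ and a candidate $c\in C$, decide whether $c$ is a possible top-$k$ winner of $\mathbf P$. (The degree of the polynomial may depend on $k$.) 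-/

import Mathlib

namespace TopKVoting

/-- A positional scoring rule: `score m j` is the score given by a ballot over `m` candidates to
the candidate at position `j`, for positions `1 ≤ j ≤ m` (other values are never used). Scores
do not increase along the ballot, and the first one exceeds the last one (for `m ≥ 2`: with a
single candidate the two are the same entry). -/
structure PositionalScoringRule where
  score : ℕ → ℕ → ℕ
  antitone : ∀ m i j, 1 ≤ i → i ≤ j → j ≤ m → score m j ≤ score m i
  nonconstant : ∀ m, 2 ≤ m → score m m < score m 1

/-- The plurality rule `(1, 0, …, 0)`. -/
def plurality : PositionalScoringRule where
  score _ j := if j = 1 then 1 else 0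
  antitone m i j hi hij hj := by split_ifs <;> omega
  nonconstant m hm := by split_ifs <;> omega

/-- The veto rule `(1, …, 1, 0)`. -/
def veto : PositionalScoringRule where
  score m j := if j = m then 0 else 1
  antitone m i j hi hij hj := by split_ifs <;> omega
  nonconstant m hm := by split_ifs <;> omega

/-- The position (from `1`) of `c` in the strict linear order `R`, where `R a b` says that `a` is
ranked above `b`. -/
noncomputable def position {C : Type} (R : C → C → Prop) (c : C) : ℕ :=
  {b : C | R b c}.ncard + 1

/-- The voting profile `T` (one strict linear order for each voter) is a completion of the partial
profile `P` (one strict partial order for each voter). -/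
def IsCompletion {C : Type} {n : ℕ} (P T : Fin n → C → C → Prop) : Prop :=
  ∀ i, IsStrictTotalOrder C (T i) ∧ ∀ a b, P i a b → T i a b

/-- The total score of `c` in the voting profile `T`. -/
noncomputable def totalScore (r : PositionalScoringRule) {C : Type} {n : ℕ}
    (T : Fin n → C → C → Prop) (c : C) : ℕ :=
  ∑ i, r.score (Nat.card C) (position (T i) c)

/-- The ranking of the candidates by their total scores, ties being broken by `tie`. -/
def outcome (r : PositionalScoringRule) {C : Type} {n : ℕ}
    (T : Fin n → C → C → Prop) (tie : C → C → Prop) (a b : C) : Prop :=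
  totalScore r T b < totalScore r T a ∨ (totalScore r T a = totalScore r T b ∧ tie a b)

/-- `c` is a top-`k` winner of the voting profile `T`. -/
def IsTopKWinner (r : PositionalScoringRule) (k : ℕ) {C : Type} {n : ℕ}
    (T : Fin n → C → C → Prop) (tie : C → C → Prop) (c : C) : Prop :=
  position (outcome r T tie) c ≤ k

/-- `c` is a possible top-`k` winner of the partial profile `P`. -/
def IsPossibleTopKWinner (r : PositionalScoringRule) (k : ℕ) {C : Type} {n : ℕ}
    (P : Fin n → C → C → Prop) (tie : C → C → Prop) (c : C) : Prop :=
  ∃ T : Fin n → C → C → Prop, IsCompletion P T ∧ IsTopKWinner r k T tie c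

/-- An input of the possible top-`k` winner problem (with `k` fixed): `m` candidates, a partial
profile of `n` voters, a tie breaker and a candidate. Orders are given by their tables. -/
structure Input where
  m : ℕ
  n : ℕ
  profile : Fin n → Fin m → Fin m → Bool
  tie : Fin m → Fin m → Bool
  c : Fin m
  profile_isStrictOrder : ∀ i, IsStrictOrder (Fin m) (fun a b => profile i a b = true)
  tie_isStrictTotalOrder : IsStrictTotalOrder (Fin m) (fun a b => tie a b = true)

/-- Unary code of a number; `none` is an end marker. -/
def encodeNat (a : ℕ) : List (Option Bool) :=
  List.replicate a (some true) ++ [none]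

/-- The table of a relation, row by row, followed by the end marker. -/
def encodeTable {m : ℕ} (R : Fin m → Fin m → Bool) : List (Option Bool) :=
  ((List.finRange m).flatMap fun a => (List.finRange m).map fun b => some (R a b)) ++ [none]

/-- The input word: the number of candidates, the index of the distinguished candidate, the table
of the tie breaker, and then the table of each voter. Its length is
`m + c + 2 + (n + 1) * (m ^ 2 + 1)`, so it is polynomially related to any usual encoding (in which
the candidates and the voters are listed explicitly). -/
def Input.encode (I : Input) : List (Option Bool) :=
  encodeNat I.m ++ encodeNat I.c ++ encodeTable I.tie ++
    (List.finRange I.n).flatMap fun i => encodeTable (I.profile i)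

/-- The possible top-`k` winner problem for the rule `r` and the fixed number `k`. -/
def PTW (r : PositionalScoringRule) (k : ℕ) (I : Input) : Prop :=
  IsPossibleTopKWinner r k (fun i a b => I.profile i a b = true) (fun a b => I.tie a b = true) I.c

/-- The decision problem `L` on the objects `a : α`, written as words `enc a` over an alphabet `Γ`,
is solved by a multi-stack Turing machine that halts within a number of steps that is bounded by a
polynomial in the length of the input word. -/
def SolvableInPolynomialTime {α Γ : Type} (enc : α → List Γ) (L : α → Prop) : Prop :=
  ∃ f : α → Bool, (∀ a, f a = true ↔ L a) ∧
    Nonempty (Turing.TM2ComputableInPolyTime enc Computability.encodeBool f)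

end TopKVoting

/-! The candidate `c` is among the top `k` exactly when at most `k - 1` rivals beat it, that is,
when some set `D` of at most `k - 1` candidates contains every rival `b` that violates `s(b) + [b
tie-precedes c] ≤ s(c)` (`isTopKWinner_iff`). For fixed `k` there are only polynomially many such
sets; they are coded by numbers with `k - 1` digits in base `m + 1` (`exists_code`), and each is
tried.

Fix `D`. Only the top (plurality) or the bottom (veto) of each ballot matters, and by Szpilrajn's
theorem it can be any maximal or minimal element of the voter's partial order. Giving `c` its best
possible score never hurts: under plurality every voter who can put `c` first does so, and under
veto only voters whose sole minimal element is `c` veto it. The score of `c` becomes a constant, and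
what remains is to assign voters to admissible candidates so that each rival outside `D` gets at
most (plurality) or at least (veto) a prescribed number of voters. Splitting candidates into
numbered places turns this into bipartite matching (`plurality_saturable_iff`,
`veto_saturable_iff`).

Matching is decided by an auction. Each round the least free left vertex takes a neighbour of least
label, evicting its holder, and that label goes up by one. If a free vertex sees only labels at
least `Q`, some label value below `Q` is unused, and the right vertices above this gap violate
Hall's condition (`AuctionInv.not_saturable`). Otherwise the sum of labels grows, so `Q * Q + 1`
rounds suffice (`allMatched_iff`). One round is a first-order update with bounded quantifiers, which
keeps the machine simple.

For the machine model, while programs on seven stacks are compiled to multi-stack Turing machines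
(`Runs.reachesIn`). Functions computable in polynomial time in unary (`PT`) are closed under bounded
sums (`PT.sum`), hence under bounded quantifiers, multiplication and division. Polynomially many
rounds of an update decidable in this sense stay polynomial, because the state is a word of bits of
bounded length (`solvableInPolynomialTime_of_iterState`). The auctions for all codes run in parallel
inside one state. -/

namespace TopKVoting

/-! ### Structured programs on a fixed collection of stacks -/

/-- The alphabet of the input word, used on all working stacks. -/
abbrev Sym := Option Bool

/-- The names of the working stacks. -/
inductive Stk
  | W | X | A | E | R | S | Y
  deriving DecidableEq

instance : Fintype Stk where
  elems := {.W, .X, .A, .E, .R, .S, .Y}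
  complete k := by cases k <;> decide

/-- The contents of the working stacks. -/
structure Mem where
  W : List Sym
  X : List Sym
  A : List Sym
  E : List Sym
  R : List Sym
  S : List Sym
  Y : List Sym

namespace Mem

def get (m : Mem) : Stk → List Sym
  | .W => m.W
  | .X => m.X
  | .A => m.A
  | .E => m.E
  | .R => m.R
  | .S => m.S
  | .Y => m.Y

def set (m : Mem) (l : List Sym) : Stk → Mem
  | .W => { m with W := l }
  | .X => { m with X := l }
  | .A => { m with A := l }
  | .E => { m with E := l }
  | .R => { m with R := l }
  | .S => { m with S := l }
  | .Y => { m with Y := l }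

theorem get_set (m : Mem) (l : List Sym) (k j : Stk) :
    (m.set l k).get j = if j = k then l else m.get j := by
  cases k <;> cases j <;> rfl

/-- Push a symbol on a stack. -/
abbrev push (m : Mem) (k : Stk) (s : Sym) : Mem := m.set (s :: m.get k) k

/-- Remove the top symbol of a stack. -/
abbrev pop (m : Mem) (k : Stk) : Mem := m.set (m.get k).tail k

end Mem

/-- While programs on stacks. The only variable is the symbol that was popped last. -/
inductive Prog
  | skip
  | push (k : Stk) (f : Option Sym → Sym)
  | pop (k : Stk)
  | seq (p q : Prog)
  | ite (c : Option Sym → Bool) (p q : Prog)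
  | whl (c : Option Sym → Bool) (p : Prog)

infixr:60 " ;; " => Prog.seq

/-- `Runs p s s' t`: started in `s`, the program `p` stops in `s'` after at most `t` steps. -/
inductive Runs : Prog → Option Sym × Mem → Option Sym × Mem → ℕ → Prop
  | skip (s) : Runs .skip s s 1
  | push (k f v m) : Runs (.push k f) (v, m) (v, m.push k (f v)) 1
  | pop (k v m) : Runs (.pop k) (v, m) ((m.get k).head?, m.pop k) 1
  | seq {p q s s' s'' t t'} : Runs p s s' t → Runs q s' s'' t' → Runs (p ;; q) s s'' (t + t')
  | ite_true {c p q v m s' t} : c v = true → Runs p (v, m) s' t →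
      Runs (.ite c p q) (v, m) s' (t + 1)
  | ite_false {c p q v m s' t} : c v = false → Runs q (v, m) s' t →
      Runs (.ite c p q) (v, m) s' (t + 1)
  | whl_true {c p v m s' s'' t t'} : c v = true → Runs p (v, m) s' t →
      Runs (.whl c p) s' s'' t' → Runs (.whl c p) (v, m) s'' (t + t' + 1)
  | whl_false {c p v m} : c v = false → Runs (.whl c p) (v, m) (v, m) 1
  | mono {p s s' t t'} : Runs p s s' t → t ≤ t' → Runs p s s' t'

/-! ### Compilation to a multi-stack Turing machine -/

/-- The stack alphabets of the compiled machine: `none` is the output stack. -/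
abbrev StkAlphabet : Option Stk → Type
  | none => Bool
  | some _ => Sym

abbrev MStmt (Λ : Type) := Turing.TM2.Stmt StkAlphabet Λ (Option Sym)

abbrev MCfg (Λ : Type) := Turing.TM2.Cfg StkAlphabet Λ (Option Sym)

namespace Prog

/-- The labels of the compiled program. -/
def Lab : Prog → Type
  | skip => Unit
  | push _ _ => Unit
  | pop _ => Unit
  | seq p q => p.Lab ⊕ q.Lab
  | ite _ p q => Unit ⊕ (p.Lab ⊕ q.Lab)
  | whl _ p => Unit ⊕ p.Lab

@[reducible]
noncomputable def labFintype : (p : Prog) → Fintype p.Lab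
  | skip => inferInstanceAs (Fintype Unit)
  | push _ _ => inferInstanceAs (Fintype Unit)
  | pop _ => inferInstanceAs (Fintype Unit)
  | seq p q => @instFintypeSum _ _ p.labFintype q.labFintype
  | ite _ p q => @instFintypeSum _ _ (inferInstanceAs (Fintype Unit))
      (@instFintypeSum _ _ p.labFintype q.labFintype)
  | whl _ p => @instFintypeSum _ _ (inferInstanceAs (Fintype Unit)) p.labFintype

noncomputable instance (p : Prog) : Fintype p.Lab := p.labFintype

/-- The entry label. -/
def start : (p : Prog) → p.Lab
  | skip => ()
  | push _ _ => ()
  | pop _ => ()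
  | seq p _ => Sum.inl p.start
  | ite _ _ _ => Sum.inl ()
  | whl _ _ => Sum.inl ()

/-- The compiled code, for an embedding `emb` of the labels of the program into those of the
machine; the control goes to `exit` at the end. -/
def code {Λ : Type} : (p : Prog) → (emb : p.Lab → Λ) → (exit : Λ) → p.Lab → MStmt Λ
  | skip, _, exit => fun _ => .goto fun _ => exit
  | push k f, _, exit => fun _ => .push (some k) f (.goto fun _ => exit)
  | pop k, _, exit => fun _ => .pop (some k) (fun _ s => s) (.goto fun _ => exit)
  | seq p q, emb, exit =>
      Sum.elim (p.code (emb ∘ Sum.inl) (emb (Sum.inr q.start))) (q.code (emb ∘ Sum.inr) exit)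
  | ite c p q, emb, exit =>
      Sum.elim (fun _ => .branch c (.goto fun _ => emb (Sum.inr (Sum.inl p.start)))
          (.goto fun _ => emb (Sum.inr (Sum.inr q.start))))
        (Sum.elim (p.code (emb ∘ Sum.inr ∘ Sum.inl) exit) (q.code (emb ∘ Sum.inr ∘ Sum.inr) exit))
  | whl c p, emb, exit =>
      Sum.elim (fun _ => .branch c (.goto fun _ => emb (Sum.inr p.start)) (.goto fun _ => exit))
        (p.code (emb ∘ Sum.inr) (emb (Sum.inl ())))

end Prog

/-- All stacks of the machine, with output `o`. -/
def memStacks (m : Mem) (o : List Bool) : (k : Option Stk) → List (StkAlphabet k)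
  | none => o
  | some k => m.get k

def mcfg {Λ : Type} (l : Option Λ) (s : Option Sym × Mem) : MCfg Λ := ⟨l, s.1, memStacks s.2 []⟩

theorem update_memStacks (m : Mem) (o : List Bool) (k : Stk) (l : List Sym) :
    Function.update (memStacks m o) (some k) l = memStacks (m.set l k) o := by
  funext j
  rcases j with _ | j
  · rfl
  · by_cases h : j = k
    · subst h
      simp [memStacks, Mem.get_set]
    · simp [memStacks, Mem.get_set, h]

/-- Reachability within `t` steps. -/
def ReachesIn {Λ : Type} (M : Λ → MStmt Λ) (t : ℕ) (a b : MCfg Λ) : Prop :=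
  ∃ n ≤ t, (flip bind (Turing.TM2.step M))^[n] (some a) = some b

theorem ReachesIn.trans {Λ : Type} {M : Λ → MStmt Λ} {t t' : ℕ} {a b c : MCfg Λ}
    (h : ReachesIn M t a b) (h' : ReachesIn M t' b c) : ReachesIn M (t + t') a c := by
  obtain ⟨n, hn, e⟩ := h
  obtain ⟨n', hn', e'⟩ := h'
  refine ⟨n' + n, by omega, ?_⟩
  rw [Function.iterate_add_apply, e, e']

theorem ReachesIn.mono {Λ : Type} {M : Λ → MStmt Λ} {t t' : ℕ} {a b : MCfg Λ}
    (h : ReachesIn M t a b) (h' : t ≤ t') : ReachesIn M t' a b := by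
  obtain ⟨n, hn, e⟩ := h
  exact ⟨n, hn.trans h', e⟩

theorem ReachesIn.single {Λ : Type} {M : Λ → MStmt Λ} {a b : MCfg Λ}
    (h : Turing.TM2.step M a = some b) : ReachesIn M 1 a b :=
  ⟨1, le_rfl, h⟩

/-- Induction on the run. The embedding and the exit label must stay general: the first half of a
sequence exits to the start of the second half, and a loop body exits to the head of its loop. -/
theorem Runs.reachesIn {Λ : Type} {M : Λ → MStmt Λ} {p : Prog} {s s' : Option Sym × Mem} {t : ℕ}
    (h : Runs p s s' t) : ∀ (emb : p.Lab → Λ) (exit : Λ), (∀ l, M (emb l) = p.code emb exit l) →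
      ReachesIn M t (mcfg (some (emb p.start)) s) (mcfg (some exit) s') := by
  induction h with
  | skip s =>
    intro emb exit hM
    apply ReachesIn.single
    simp [mcfg, hM, Prog.code]
  | push k f v m =>
    intro emb exit hM
    apply ReachesIn.single
    simp only [mcfg, Turing.TM2.step, hM, Prog.code, Turing.TM2.stepAux, Option.some.injEq]
    congr 1
    exact update_memStacks m [] k _
  | pop k v m =>
    intro emb exit hM
    apply ReachesIn.single
    simp only [mcfg, Turing.TM2.step, hM, Prog.code, Turing.TM2.stepAux, Option.some.injEq]
    congr 1
    exact update_memStacks m [] k _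
  | @seq p q s s' s'' t t' _ _ ih ih' =>
    intro emb exit hM
    exact (ih (emb ∘ Sum.inl) (emb (Sum.inr q.start)) fun l => hM (Sum.inl l)).trans
      (ih' (emb ∘ Sum.inr) exit fun l => hM (Sum.inr l))
  | @ite_true c p q v m s' t hc _ ih =>
    intro emb exit hM
    rw [add_comm]
    refine (ReachesIn.single ?_).trans (ih (emb ∘ Sum.inr ∘ Sum.inl) exit
      fun l => hM (Sum.inr (Sum.inl l)))
    have := hM (Sum.inl ())
    simp only [Prog.code, Sum.elim_inl] at this
    simp [mcfg, Prog.start, this, hc]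
    rfl
  | @ite_false c p q v m s' t hc _ ih =>
    intro emb exit hM
    rw [add_comm]
    refine (ReachesIn.single ?_).trans (ih (emb ∘ Sum.inr ∘ Sum.inr) exit
      fun l => hM (Sum.inr (Sum.inr l)))
    have := hM (Sum.inl ())
    simp only [Prog.code, Sum.elim_inl] at this
    simp [mcfg, Prog.start, this, hc]
    rfl
  | @whl_true c p v m s' s'' t t' hc _ _ ih ih' =>
    intro emb exit hM
    rw [add_comm]
    refine (ReachesIn.single ?_).trans ((ih (emb ∘ Sum.inr) (emb (Sum.inl ()))
      fun l => hM (Sum.inr l)).trans (ih' emb exit hM))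
    have := hM (Sum.inl ())
    simp only [Prog.code, Sum.elim_inl] at this
    simp [mcfg, Prog.start, this, hc]
    rfl
  | @whl_false c p v m hc =>
    intro emb exit hM
    refine ReachesIn.single ?_
    have := hM (Sum.inl ())
    simp only [Prog.code, Sum.elim_inl] at this
    simp [mcfg, Prog.start, this, hc]
  | mono _ hle ih =>
    intro emb exit hM
    exact (ih emb exit hM).mono hle

/-- The empty memory. -/
def Mem.empty : Mem := ⟨[], [], [], [], [], [], []⟩

/-- The machine that runs `p` with the input on the stack `W`, and then outputs whether the last
popped symbol is `some true`. -/
noncomputable def machine (p : Prog) : Turing.FinTM2 where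
  K := Option Stk
  k₀ := some .W
  k₁ := none
  Γ := StkAlphabet
  Λ := Option p.Lab
  main := some p.start
  σ := Option Sym
  initialState := none
  Γk₀Fin := inferInstanceAs (Fintype (Option Bool))
  m
  | some l => p.code some none l
  | none => .push none (fun v => decide (v = some (some true))) (.load (fun _ => none) .halt)

/-- The extra step pushes the answer, resets the variable and halts. A halting configuration must
have all stacks but the output empty, which is why the run is required to end in `Mem.empty`. -/
theorem machine_outputs (p : Prog) (w : List Sym) (v : Option Sym) (t : ℕ)
    (h : Runs p (none, ⟨w, [], [], [], [], [], []⟩) (v, Mem.empty) t) :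
    Nonempty (Turing.TM2OutputsInTime (machine p) w
      (some [decide (v = some (some true))]) (t + 1)) := by
  have h1 := h.reachesIn (M := (machine p).m) some none (fun l => rfl)
  have h2 : ReachesIn (machine p).m 1 (mcfg (some none) (v, Mem.empty))
      (Turing.haltList (machine p) [decide (v = some (some true))]) := by
    apply ReachesIn.single
    simp only [mcfg, Turing.TM2.step, Turing.haltList]
    simp only [machine, Turing.TM2.stepAux, Option.some.injEq]
    congr 1
    funext j
    rcases j with _ | j
    · rfl
    · cases j <;> simp [memStacks, Mem.get, Mem.empty]
  have h3 : (mcfg (some (some p.start)) (none, ⟨w, [], [], [], [], [], []⟩) :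
      MCfg (Option p.Lab)) = Turing.initList (machine p) w := by
    simp only [mcfg, Turing.initList]
    congr 1
    funext j
    rcases j with _ | j
    · simp [memStacks, machine]
    · cases j <;> rfl
  obtain ⟨n, hn, e⟩ := h1.trans h2
  have h4 := congrArg (fun c => (flip bind (Turing.TM2.step (machine p).m))^[n] (some c)) h3
  exact ⟨⟨⟨n, h4.symm.trans e⟩, hn⟩⟩

theorem solvableInPolynomialTime_of_prog {α : Type} (enc : α → List (Option Bool)) (L : α → Prop)
    (p : Prog) (q : Polynomial ℕ)
    (h : ∀ a, ∃ v, Runs p (none, ⟨enc a, [], [], [], [], [], []⟩) (v, Mem.empty)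
      (q.eval (enc a).length) ∧ (v = some (some true) ↔ L a)) :
    SolvableInPolynomialTime enc L := by
  classical
  choose v hv hL using h
  refine ⟨fun a => decide (L a), fun a => by simp, ⟨⟨⟨machine p, Equiv.refl _, Equiv.refl _⟩,
    q + 1, fun a => ?_⟩⟩⟩
  have h1 := (machine_outputs p (enc a) (v a) _ (hv a)).some
  have e : decide (v a = some (some true)) = decide (L a) := by simp [hL]
  rw [e] at h1
  exact cast (congrArg₂ (fun l t => Turing.TM2OutputsInTime (machine p) l
    (some [decide (L a)]) t) (List.map_id (enc a)).symm
    (by simp : Polynomial.eval (enc a).length q + 1 = (q + 1).eval (enc a).length)) h1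

/-! ### Unary numbers on stacks and basic loops -/

/-- `n` marks on top of `l`. -/
def ones : ℕ → List Sym → List Sym
  | 0, l => l
  | n + 1, l => some true :: ones n l

/-- The unary code of `n` on top of `l`. -/
def num (n : ℕ) (l : List Sym) : List Sym := ones n (none :: l)

@[simp] theorem length_ones (n : ℕ) (l : List Sym) : (ones n l).length = n + l.length := by
  induction n with
  | zero => simp [ones]
  | succ n ih => simp [ones, ih]; omega

@[simp] theorem length_num (n : ℕ) (l : List Sym) : (num n l).length = n + l.length + 1 := by
  simp [num]; omega

theorem ones_sub {i n : ℕ} (h : i < n) (l : List Sym) :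
    ones (n - i) l = some true :: ones (n - (i + 1)) l := by
  obtain ⟨j, rfl⟩ : ∃ j, n = i + j + 1 := ⟨n - i - 1, by omega⟩
  rw [show i + j + 1 - i = j + 1 by omega, show i + j + 1 - (i + 1) = j by omega]
  rfl

theorem ones_ones (m n : ℕ) (l : List Sym) : ones m (ones n l) = ones (m + n) l := by
  induction m with
  | zero => simp [ones]
  | succ m ih => rw [Nat.succ_add, ones, ones, ih]

/-- A list of unary codes on top of `rest`. -/
def nums (l : List ℕ) (rest : List Sym) : List Sym := l.foldr num rest

theorem Mem.ext_get {m m' : Mem} (h : ∀ k, m.get k = m'.get k) : m = m' := by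
  have h1 := h .W
  have h2 := h .X
  have h3 := h .A
  have h5 := h .E
  have h6 := h .R
  have h7 := h .S
  have h8 := h .Y
  cases m
  cases m'
  simp only [Mem.get] at h1 h2 h3 h5 h6 h7 h8
  simp [*]

/-- `p` transforms the memory `m` to `m'` in time `t`, whatever was popped before. -/
def Run (p : Prog) (m m' : Mem) (t : ℕ) : Prop := ∀ v, ∃ v', Runs p (v, m) (v', m') t

theorem Run.seq {p q : Prog} {m m' m'' : Mem} {t t' : ℕ} (h : Run p m m' t)
    (h' : Run q m' m'' t') : Run (p ;; q) m m'' (t + t') := by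
  intro v
  obtain ⟨v', hv⟩ := h v
  obtain ⟨v'', hv'⟩ := h' v'
  exact ⟨v'', hv.seq hv'⟩

theorem Run.mono {p : Prog} {m m' : Mem} {t t' : ℕ} (h : Run p m m' t) (ht : t ≤ t') :
    Run p m m' t' := by
  intro v
  obtain ⟨v', hv⟩ := h v
  exact ⟨v', hv.mono ht⟩

theorem Run.push (k : Stk) (s : Sym) (m : Mem) :
    Run (.push k fun _ => s) m (m.push k s) 1 :=
  fun v => ⟨v, .push k _ v m⟩

/-- Pop from `k` and execute `p` as long as the popped symbol satisfies `c`. -/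
def loop (k : Stk) (c : Option Sym → Bool) (p : Prog) : Prog := .pop k ;; .whl c (p ;; .pop k)

/-- `F i` is the memory just before the pop when `i` iterations remain, so the family is indexed
downwards. Each iteration costs the body, a pop and a test; the final `+ 2` is the initial pop and
the failing test. -/
theorem Runs.loop {k : Stk} {c : Option Sym → Bool} {p : Prog} (F : ℕ → Mem) (n t : ℕ)
    (h0 : c ((F 0).get k).head? = false)
    (hc : ∀ i < n, c ((F (i + 1)).get k).head? = true)
    (hp : ∀ i < n, ∃ v', Runs p (((F (i + 1)).get k).head?, (F (i + 1)).pop k) (v', F i) t)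
    (v : Option Sym) :
    Runs (loop k c p) (v, F n) (((F 0).get k).head?, (F 0).pop k) (n * (t + 2) + 2) := by
  have key : ∀ i ≤ n, Runs (.whl c (p ;; .pop k)) (((F i).get k).head?, (F i).pop k)
      (((F 0).get k).head?, (F 0).pop k) (i * (t + 2) + 1) := by
    intro i
    induction i with
    | zero => exact fun _ => (Runs.whl_false h0).mono (by omega)
    | succ i ih =>
      intro hi
      obtain ⟨v', hv⟩ := hp i hi
      refine (Runs.whl_true (hc i hi) (hv.seq (.pop k v' (F i))) (ih (by omega))).mono ?_
      rw [Nat.succ_mul]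
      omega
  exact ((Runs.pop k v (F n)).seq (key n le_rfl)).mono (by omega)

theorem Run.loop {k : Stk} {c : Option Sym → Bool} {p : Prog} (F : ℕ → Mem) (n t : ℕ)
    (h0 : c ((F 0).get k).head? = false)
    (hc : ∀ i < n, c ((F (i + 1)).get k).head? = true)
    (hp : ∀ i < n, ∃ v', Runs p (((F (i + 1)).get k).head?, (F (i + 1)).pop k) (v', F i) t) :
    Run (loop k c p) (F n) ((F 0).pop k) (n * (t + 2) + 2) :=
  fun v => ⟨_, Runs.loop F n t h0 hc hp v⟩

def isTrue (v : Option Sym) : Bool := decide (v = some (some true))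

@[simp] theorem isTrue_true : isTrue (some (some true)) = true := rfl
@[simp] theorem isTrue_none : isTrue none = false := rfl
@[simp] theorem isTrue_some_none : isTrue (some none) = false := rfl

/-- Move the marks on `k₁` to `k₂` and remove the symbol below them. -/
def moveOnes (k₁ k₂ : Stk) : Prog := loop k₁ isTrue (.push k₂ fun _ => some true)

theorem Run.moveOnes {k₁ k₂ : Stk} (hne : k₂ ≠ k₁) {m : Mem} {n : ℕ} {l : List Sym}
    (hm : m.get k₁ = ones n l) (hl : isTrue l.head? = false) :
    Run (moveOnes k₁ k₂) m ((m.set l.tail k₁).set (ones n (m.get k₂)) k₂) (3 * n + 2) := by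
  have h := Run.loop (k := k₁) (c := isTrue) (p := .push k₂ fun _ => some true)
    (fun i => (m.set (ones i l) k₁).set (ones (n - i) (m.get k₂)) k₂) n 1
    (by simpa [Mem.get_set, hne.symm, ones] using hl)
    (fun i hi => by simp [Mem.get_set, hne.symm, ones])
    (fun i hi => ⟨_, by
      convert! Runs.push k₂ _ _ _ using 2
      apply Mem.ext_get
      intro k
      have := ones_sub hi (m.get k₂)
      simp only [Mem.get_set]
      split_ifs <;> simp_all [ones]⟩)
  convert! h.mono (t' := 3 * n + 2) (by omega) using 1
  · apply Mem.ext_get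
    intro k
    simp only [Mem.get_set]
    split_ifs <;> simp_all [ones]
  · apply Mem.ext_get
    intro k
    simp only [Mem.get_set]
    split_ifs <;> simp_all [ones]

/-- Remove the marks on `k` and the symbol below them. -/
def dropOnes (k : Stk) : Prog := loop k isTrue .skip

theorem Run.dropOnes {k : Stk} {m : Mem} {n : ℕ} {l : List Sym}
    (hm : m.get k = ones n l) (hl : isTrue l.head? = false) :
    Run (dropOnes k) m (m.set l.tail k) (3 * n + 2) := by
  have h := Run.loop (k := k) (c := isTrue) (p := .skip) (fun i => m.set (ones i l) k) n 1
    (by simpa [Mem.get_set, ones] using hl)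
    (fun i hi => by simp [Mem.get_set, ones])
    (fun i hi => ⟨_, by
      convert! Runs.skip _ using 2
      apply Mem.ext_get
      intro k
      simp only [Mem.get_set]
      split_ifs <;> simp_all [ones]⟩)
  convert! h.mono (t' := 3 * n + 2) (by omega) using 1
  · apply Mem.ext_get
    intro k
    simp only [Mem.get_set]
    split_ifs <;> simp_all
  · apply Mem.ext_get
    intro k
    simp only [Mem.get_set]
    split_ifs <;> simp_all [ones]

/-- Empty the stack `k`. -/
def clear (k : Stk) : Prog := loop k Option.isSome .skip

theorem drop_sub {β : Type} (l : List β) {i : ℕ} (hi : i < l.length) :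
    l.drop (l.length - (i + 1)) =
      l[l.length - (i + 1)] :: l.drop (l.length - i) := by
  rw [List.drop_eq_getElem_cons (by omega), show l.length - (i + 1) + 1 = l.length - i by omega]

theorem take_sub {β : Type} (l : List β) {i : ℕ} (hi : i < l.length) :
    (l.take (l.length - i)).reverse =
      l[l.length - (i + 1)] :: (l.take (l.length - (i + 1))).reverse := by
  rw [show l.length - i = l.length - (i + 1) + 1 by omega, List.take_succ_eq_append_getElem]
  · simp
  · omega

theorem Run.clear {k : Stk} (m : Mem) :
    Run (clear k) m (m.set [] k) (3 * (m.get k).length + 2) := by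
  have h := Run.loop (k := k) (c := Option.isSome) (p := .skip)
    (fun i => m.set ((m.get k).drop ((m.get k).length - i)) k) (m.get k).length 1
    (by simp [Mem.get_set])
    (fun i hi => by simp [Mem.get_set, drop_sub _ hi])
    (fun i hi => ⟨_, by
      convert! Runs.skip _ using 2
      apply Mem.ext_get
      intro k
      simp only [Mem.get_set, drop_sub _ hi]
      split_ifs <;> simp_all⟩)
  convert! h.mono (t' := 3 * (m.get k).length + 2) (by omega) using 1
  · apply Mem.ext_get
    intro k
    simp only [Mem.get_set]
    split_ifs <;> simp_all
  · apply Mem.ext_get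
    intro k
    simp only [Mem.get_set]
    split_ifs <;> simp_all

/-- Move the contents of `k₁` to `k₂`, in reverse order. -/
def moveAll (k₁ k₂ : Stk) : Prog := loop k₁ Option.isSome (.push k₂ fun v => v.getD none)

theorem Run.moveAll {k₁ k₂ : Stk} (hne : k₂ ≠ k₁) (m : Mem) :
    Run (moveAll k₁ k₂) m ((m.set [] k₁).set ((m.get k₁).reverse ++ m.get k₂) k₂)
      (3 * (m.get k₁).length + 2) := by
  have h := Run.loop (k := k₁) (c := Option.isSome) (p := .push k₂ fun v => v.getD none)
    (fun i => (m.set ((m.get k₁).drop ((m.get k₁).length - i)) k₁).set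
      (((m.get k₁).take ((m.get k₁).length - i)).reverse ++ m.get k₂) k₂) (m.get k₁).length 1
    (by simp [Mem.get_set, hne.symm])
    (fun i hi => by simp [Mem.get_set, hne.symm, drop_sub _ hi])
    (fun i hi => ⟨_, by
      convert! Runs.push k₂ _ _ _ using 2
      apply Mem.ext_get
      intro k
      simp only [Mem.get_set, drop_sub _ hi, take_sub _ hi]
      split_ifs <;> simp_all⟩)
  convert! h.mono (t' := 3 * (m.get k₁).length + 2) (by omega) using 1
  · apply Mem.ext_get
    intro k
    simp only [Mem.get_set]
    split_ifs <;> simp_all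
  · apply Mem.ext_get
    intro k
    simp only [Mem.get_set]
    split_ifs <;> simp_all

/-! ### Functions with values in `ℕ` computed in polynomial time in unary -/

/-- The inputs of a program: an input word, a word that stores the state of an iteration, and
number variables. -/
class Ctx (α : Type) where
  inp : α → List Sym
  sta : α → List Sym
  vars : α → List ℕ

/-- The input word and the state word. -/
structure Tapes where
  inp : List Sym
  sta : List Sym

instance : Ctx Tapes := ⟨Tapes.inp, Tapes.sta, fun _ => []⟩

/-- Bound variables in de Bruijn style: the innermost one is the second component and lies on top of
the environment. -/
instance {α : Type} [Ctx α] : Ctx (α × ℕ) :=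
  ⟨fun a => Ctx.inp a.1, fun a => Ctx.sta a.1, fun a => a.2 :: Ctx.vars a.1⟩

section PT

variable {α : Type} [Ctx α]

open Ctx Polynomial

/-- The number variables on top of `rest`. -/
def env (a : α) (rest : List Sym) : List Sym := nums (vars a) rest

/-- The program `p` pushes the unary code of `f a` on the stack `E` in time `t`. -/
def Computes (p : Prog) (a : α) (v t : ℕ) (rest : List Sym) : Prop :=
  ∀ r s y, Run p ⟨inp a, sta a, [], env a rest, r, s, y⟩
    ⟨inp a, sta a, [], num v (env a rest), r, s, y⟩ t

/-- `f` is computed in polynomial time, numbers being written in unary. -/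
def PT (f : α → ℕ) : Prop :=
  ∃ (p : Prog) (P : Polynomial ℕ), ∀ (a : α) (rest : List Sym) (N : ℕ),
    (env a rest).length + (inp a).length + (sta a).length ≤ N →
      f a ≤ P.eval N ∧ Computes p a (f a) (P.eval N) rest

theorem PT.zero : PT fun _ : α => 0 := by
  refine ⟨.push .E fun _ => none, 1, fun a rest N _ => ⟨by simp, fun r s y => ?_⟩⟩
  rw [eval_one]
  exact Run.push .E none _

theorem PT.succ {f : α → ℕ} (hf : PT f) : PT fun a => f a + 1 := by
  obtain ⟨p, P, h⟩ := hf
  refine ⟨p ;; .push .E fun _ => some true, P + 1, fun a rest N hN => ?_⟩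
  obtain ⟨h1, h2⟩ := h a rest N hN
  rw [eval_add, eval_one]
  exact ⟨by dsimp only; omega, fun r s y => (h2 r s y).seq (Run.push .E (some true) _)⟩

theorem PT.const (n : ℕ) : PT fun _ : α => n := by
  induction n with
  | zero => exact PT.zero
  | succ n ih => exact ih.succ

/-- The first value is parked on `R`, so that the second program again finds the bare environment on
`E`. This works because `Computes` allows arbitrary contents of `R`, `S` and `Y`. -/
theorem PT.add {f g : α → ℕ} (hf : PT f) (hg : PT g) : PT fun a => f a + g a := by
  obtain ⟨p, P, h⟩ := hf
  obtain ⟨q, Q, h'⟩ := hg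
  refine ⟨p ;; .push .R (fun _ => none) ;; moveOnes .E .R ;; q ;; moveOnes .R .E,
    7 * P + Q + 5, fun a rest N hN => ?_⟩
  obtain ⟨h1, h2⟩ := h a rest N hN
  obtain ⟨h3, h4⟩ := h' a rest N hN
  have e7 : eval N (7 : Polynomial ℕ) = 7 := eval_natCast (n := 7)
  have e5 : eval N (5 : Polynomial ℕ) = 5 := eval_natCast (n := 5)
  rw [eval_add, eval_add, eval_mul, e7, e5]
  refine ⟨by dsimp only; omega, fun r s y => ?_⟩
  have s1 := h2 r s y
  have s2 := Run.push .R none ⟨inp a, sta a, [], num (f a) (env a rest), r, s, y⟩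
  have s3 := Run.moveOnes (k₁ := .E) (k₂ := .R) (by decide)
    (m := ⟨inp a, sta a, [], num (f a) (env a rest), none :: r, s, y⟩) (n := f a)
    (l := none :: env a rest) rfl rfl
  have s4 := h4 (ones (f a) (none :: r)) s y
  have s5 := Run.moveOnes (k₁ := .R) (k₂ := .E) (by decide)
    (m := ⟨inp a, sta a, [], num (g a) (env a rest), ones (f a) (none :: r), s, y⟩)
    (n := f a) (l := none :: r) rfl rfl
  have e : num (f a + g a) (env a rest) = ones (f a) (num (g a) (env a rest)) := by
    rw [num, num, ones_ones]
  rw [e]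
  exact (s1.seq (s2.seq (s3.seq (s4.seq s5)))).mono (by omega)

/-- Every mark of `g` removes one mark of `f`; when the end marker is popped instead, it is put
back, and this is what truncates the subtraction at zero. -/
theorem PT.sub {f g : α → ℕ} (hf : PT f) (hg : PT g) : PT fun a => f a - g a := by
  obtain ⟨p, P, h⟩ := hf
  obtain ⟨q, Q, h'⟩ := hg
  refine ⟨q ;; .push .R (fun _ => none) ;; moveOnes .E .R ;; p ;;
    loop .R isTrue (.pop .E ;; .ite isTrue .skip (.push .E fun _ => none)),
    P + 9 * Q + 5, fun a rest N hN => ?_⟩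
  obtain ⟨h1, h2⟩ := h a rest N hN
  obtain ⟨h3, h4⟩ := h' a rest N hN
  have e9 : eval N (9 : Polynomial ℕ) = 9 := eval_natCast (n := 9)
  have e5 : eval N (5 : Polynomial ℕ) = 5 := eval_natCast (n := 5)
  rw [eval_add, eval_add, eval_mul, e9, e5]
  refine ⟨by dsimp only; omega, fun r s y => ?_⟩
  have s1 := h4 r s y
  have s2 := Run.push .R none ⟨inp a, sta a, [], num (g a) (env a rest), r, s, y⟩
  have s3 := Run.moveOnes (k₁ := .E) (k₂ := .R) (by decide)
    (m := ⟨inp a, sta a, [], num (g a) (env a rest), none :: r, s, y⟩) (n := g a)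
    (l := none :: env a rest) rfl rfl
  have s4 := h2 (ones (g a) (none :: r)) s y
  have s5 := Run.loop (k := .R) (c := isTrue)
    (p := .pop .E ;; .ite isTrue .skip (.push .E fun _ => none))
    (fun i => ⟨inp a, sta a, [], num (f a - (g a - i)) (env a rest),
      ones i (none :: r), s, y⟩) (g a) 3 rfl (fun i hi => rfl) (fun i hi => by
        rcases Nat.lt_or_ge (g a - (i + 1)) (f a) with hlt | hge
        · obtain ⟨j, hj⟩ : ∃ j, f a - (g a - (i + 1)) = j + 1 := ⟨_, (Nat.succ_pred (by omega)).symm⟩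
          have hj' : f a - (g a - i) = j := by omega
          rw [hj, hj']
          exact ⟨_, ((Runs.pop .E _ _).seq (.ite_true rfl (.skip _)))⟩
        · have hj : f a - (g a - (i + 1)) = 0 := by omega
          have hj' : f a - (g a - i) = 0 := by omega
          rw [hj, hj']
          exact ⟨_, ((Runs.pop .E _ _).seq (.ite_false rfl (.push .E _ _ _)))⟩)
  simp only [Nat.sub_self, Nat.sub_zero] at s5
  exact (s1.seq (s2.seq (s3.seq (s4.seq s5)))).mono (by omega)

/-- The top variable hides the environment of `f`. It is set aside on `R` during the evaluation and
restored while the result waits on `S`. -/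
theorem PT.weaken {f : α → ℕ} (hf : PT f) : PT fun a : α × ℕ => f a.1 := by
  obtain ⟨p, P, h⟩ := hf
  refine ⟨.push .R (fun _ => none) ;; moveOnes .E .R ;; p ;;
    .push .S (fun _ => none) ;; moveOnes .E .S ;; .push .E (fun _ => none) ;; moveOnes .R .E ;;
    .push .E (fun _ => none) ;; moveOnes .S .E, 6 * X + 7 * P + 12, fun ⟨a, j⟩ rest N hN => ?_⟩
  have hN' : (num j (env a rest)).length + (inp a).length + (sta a).length ≤ N := hN
  rw [length_num] at hN'
  obtain ⟨h1, h2⟩ := h a rest N (by omega)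
  have e6 : eval N (6 : Polynomial ℕ) = 6 := eval_natCast (n := 6)
  have e7 : eval N (7 : Polynomial ℕ) = 7 := eval_natCast (n := 7)
  have e12 : eval N (12 : Polynomial ℕ) = 12 := eval_natCast (n := 12)
  rw [eval_add, eval_add, eval_mul, eval_mul, e6, e7, e12, eval_X]
  refine ⟨by dsimp only; omega, fun r s y => ?_⟩
  have s1 := Run.push .R none ⟨inp a, sta a, [], num j (env a rest), r, s, y⟩
  have s2 := Run.moveOnes (k₁ := .E) (k₂ := .R) (by decide)
    (m := ⟨inp a, sta a, [], num j (env a rest), none :: r, s, y⟩) (n := j)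
    (l := none :: env a rest) rfl rfl
  have s3 := h2 (ones j (none :: r)) s y
  have s4 := Run.push .S none
    ⟨inp a, sta a, [], num (f a) (env a rest), ones j (none :: r), s, y⟩
  have s5 := Run.moveOnes (k₁ := .E) (k₂ := .S) (by decide)
    (m := ⟨inp a, sta a, [], num (f a) (env a rest), ones j (none :: r), none :: s, y⟩)
    (n := f a) (l := none :: env a rest) rfl rfl
  have s6 := Run.push .E none
    ⟨inp a, sta a, [], env a rest, ones j (none :: r), ones (f a) (none :: s), y⟩
  have s7 := Run.moveOnes (k₁ := .R) (k₂ := .E) (by decide)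
    (m := ⟨inp a, sta a, [], none :: env a rest, ones j (none :: r), ones (f a) (none :: s), y⟩)
    (n := j) (l := none :: r) rfl rfl
  have s8 := Run.push .E none
    ⟨inp a, sta a, [], num j (env a rest), r, ones (f a) (none :: s), y⟩
  have s9 := Run.moveOnes (k₁ := .S) (k₂ := .E) (by decide)
    (m := ⟨inp a, sta a, [], none :: num j (env a rest), r, ones (f a) (none :: s), y⟩)
    (n := f a) (l := none :: s) rfl rfl
  exact (s1.seq (s2.seq (s3.seq (s4.seq (s5.seq (s6.seq (s7.seq (s8.seq s9)))))))).mono (by omega)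

/-- Reading a unary number destroys it, so two copies are made, on `R` and on `S`, and both are
moved back. -/
theorem PT.var : PT fun a : α × ℕ => a.2 := by
  refine ⟨.push .R (fun _ => none) ;; .push .S (fun _ => none) ;;
    loop .E isTrue (.push .R (fun _ => some true) ;; .push .S fun _ => some true) ;;
    .push .E (fun _ => none) ;; moveOnes .R .E ;; .push .E (fun _ => none) ;; moveOnes .S .E,
    10 * X + 10, fun ⟨a, j⟩ rest N hN => ?_⟩
  have hN' : (num j (env a rest)).length + (inp a).length + (sta a).length ≤ N := hN
  rw [length_num] at hN'
  have e10 : eval N (10 : Polynomial ℕ) = 10 := eval_natCast (n := 10)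
  rw [eval_add, eval_mul, e10, eval_X]
  refine ⟨by dsimp only; omega, fun r s y => ?_⟩
  have s1 := Run.push .R none ⟨inp a, sta a, [], num j (env a rest), r, s, y⟩
  have s2 := Run.push .S none ⟨inp a, sta a, [], num j (env a rest), none :: r, s, y⟩
  have s3 := Run.loop (k := .E) (c := isTrue)
    (p := .push .R (fun _ => some true) ;; .push .S fun _ => some true)
    (fun i => ⟨inp a, sta a, [], num i (env a rest), ones (j - i) (none :: r),
      ones (j - i) (none :: s), y⟩) j 2 rfl (fun i hi => rfl) (fun i hi => by
        rw [ones_sub hi, ones_sub hi]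
        exact ((Run.push .R (some true) _).seq (Run.push .S (some true) _)) _)
  simp only [Nat.sub_self, Nat.sub_zero] at s3
  have s4 := Run.push .E none
    ⟨inp a, sta a, [], env a rest, ones j (none :: r), ones j (none :: s), y⟩
  have s5 := Run.moveOnes (k₁ := .R) (k₂ := .E) (by decide)
    (m := ⟨inp a, sta a, [], none :: env a rest, ones j (none :: r), ones j (none :: s), y⟩)
    (n := j) (l := none :: r) rfl rfl
  have s6 := Run.push .E none
    ⟨inp a, sta a, [], num j (env a rest), r, ones j (none :: s), y⟩
  have s7 := Run.moveOnes (k₁ := .S) (k₂ := .E) (by decide)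
    (m := ⟨inp a, sta a, [], none :: num j (env a rest), r, ones j (none :: s), y⟩)
    (n := j) (l := none :: s) rfl rfl
  exact (s1.seq (s2.seq (s3.seq (s4.seq (s5.seq (s6.seq s7)))))).mono (by omega)

/-- `R` counts the remaining terms, `S` accumulates the sum, and the index lies on top of `E`, where
the program of the summand expects its bound variable. -/
theorem PT.sum {f : α → ℕ} {g : α → ℕ → ℕ} (hf : PT f) (hg : PT fun a : α × ℕ => g a.1 a.2) :
    PT fun a => ∑ i ∈ Finset.range (f a), g a i := by
  obtain ⟨p, P, h⟩ := hf
  obtain ⟨q, Q, h'⟩ := hg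
  refine ⟨p ;; .push .R (fun _ => none) ;; moveOnes .E .R ;; .push .S (fun _ => none) ;;
    .push .E (fun _ => none) ;;
    loop .R isTrue (q ;; moveOnes .E .S ;; .push .E fun _ => some true) ;;
    dropOnes .E ;; .push .E (fun _ => none) ;; moveOnes .S .E,
    12 * P + 7 * (P * Q.comp (X + P + 1)) + 20, fun a rest N hN => ?_⟩
  obtain ⟨h1, h2⟩ := h a rest N hN
  have e7 : eval N (7 : Polynomial ℕ) = 7 := eval_natCast (n := 7)
  have e12 : eval N (12 : Polynomial ℕ) = 12 := eval_natCast (n := 12)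
  have e20 : eval N (20 : Polynomial ℕ) = 20 := eval_natCast (n := 20)
  simp only [eval_add, eval_mul, e7, e12, e20, eval_X, eval_comp, eval_one]
  set n := f a with hn
  -- The index is below `f a ≤ eval N P`, and its unary code with the end marker lengthens the
  -- environment by at most `eval N P`, so `N'` bounds the input size of every term.
  set N' := N + eval N P + 1 with hN'
  have hb : ∀ j < n, g a j ≤ Q.eval N' ∧ Computes q (a, j) (g a j) (Q.eval N') rest := by
    intro j hj
    refine h' (a, j) rest N' ?_
    have : (num j (env a rest)).length + (inp a).length + (sta a).length ≤ N' := by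
      rw [length_num]
      omega
    exact this
  set G := fun j => ∑ i ∈ Finset.range j, g a i with hG
  have hGn : G n ≤ eval N P * eval N' Q := by
    calc G n ≤ n * eval N' Q := by
          simpa using Finset.sum_le_card_nsmul (Finset.range n) (g a) (eval N' Q)
            (fun i hi => (hb i (Finset.mem_range.1 hi)).1)
      _ ≤ _ := Nat.mul_le_mul_right _ h1
  refine ⟨by change G n ≤ _; omega, fun r s y => ?_⟩
  change Run _ _ ⟨inp a, sta a, [], num (G n) (env a rest), r, s, y⟩ _
  have s1 := h2 r s y
  have s2 := Run.push .R none ⟨inp a, sta a, [], num n (env a rest), r, s, y⟩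
  have s3 := Run.moveOnes (k₁ := .E) (k₂ := .R) (by decide)
    (m := ⟨inp a, sta a, [], num n (env a rest), none :: r, s, y⟩) (n := n)
    (l := none :: env a rest) rfl rfl
  have s4 := Run.push .S none ⟨inp a, sta a, [], env a rest, ones n (none :: r), s, y⟩
  have s5 := Run.push .E none ⟨inp a, sta a, [], env a rest, ones n (none :: r), none :: s, y⟩
  have s6 := Run.loop (k := .R) (c := isTrue)
    (p := q ;; moveOnes .E .S ;; .push .E fun _ => some true)
    (fun i => ⟨inp a, sta a, [], num (n - i) (env a rest), ones i (none :: r),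
      ones (G (n - i)) (none :: s), y⟩) n (4 * eval N' Q + 3) rfl (fun i hi => rfl)
    (fun i hi => by
      obtain ⟨b1, b2⟩ := hb (n - (i + 1)) (by omega)
      have t1 := b2 (ones i (none :: r)) (ones (G (n - (i + 1))) (none :: s)) y
      have t2 := Run.moveOnes (k₁ := .E) (k₂ := .S) (by decide)
        (m := ⟨inp a, sta a, [], num (g a (n - (i + 1))) (num (n - (i + 1)) (env a rest)),
          ones i (none :: r), ones (G (n - (i + 1))) (none :: s), y⟩) (n := g a (n - (i + 1)))
        (l := none :: num (n - (i + 1)) (env a rest)) rfl rfl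
      have t3 := Run.push .E (some true) ⟨inp a, sta a, [], num (n - (i + 1)) (env a rest),
        ones i (none :: r), ones (g a (n - (i + 1))) (ones (G (n - (i + 1))) (none :: s)), y⟩
      have e1 : G (n - i) = g a (n - (i + 1)) + G (n - (i + 1)) := by
        rw [show n - i = n - (i + 1) + 1 by omega, hG]
        simp only [Finset.sum_range_succ]
        rw [add_comm]
      have e2 : num (n - i) (env a rest) = some true :: num (n - (i + 1)) (env a rest) :=
        ones_sub hi _
      have e3 : ones (G (n - i)) (none :: s) =
          ones (g a (n - (i + 1))) (ones (G (n - (i + 1))) (none :: s)) := by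
        rw [e1, ones_ones]
      rw [e2, e3]
      exact (t1.seq (t2.seq t3)).mono (t' := 4 * eval N' Q + 3) (by omega) _)
  simp only [Nat.sub_self, Nat.sub_zero] at s6
  have s7 := Run.dropOnes (k := .E)
    (m := ⟨inp a, sta a, [], num n (env a rest), r, ones (G n) (none :: s), y⟩) (n := n)
    (l := none :: env a rest) rfl rfl
  have s8 := Run.push .E none ⟨inp a, sta a, [], env a rest, r, ones (G n) (none :: s), y⟩
  have s9 := Run.moveOnes (k₁ := .S) (k₂ := .E) (by decide)
    (m := ⟨inp a, sta a, [], none :: env a rest, r, ones (G n) (none :: s), y⟩)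
    (n := G n) (l := none :: s) rfl rfl
  refine (s1.seq (s2.seq (s3.seq (s4.seq (s5.seq (s6.seq (s7.seq (s8.seq s9)))))))).mono ?_
  have h3 : n * (4 * eval N' Q + 3 + 2) ≤ 4 * (eval N P * eval N' Q) + 5 * eval N P := by
    calc n * (4 * eval N' Q + 3 + 2) ≤ eval N P * (4 * eval N' Q + 3 + 2) :=
          Nat.mul_le_mul_right _ h1
      _ = _ := by ring
  omega

theorem PT.length_inp : PT fun a : α => (inp a).length := by
  refine ⟨.push .S (fun _ => none) ;; loop .W Option.isSome
    (.push .A (fun v => v.getD none) ;; .push .S fun _ => some true) ;;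
    moveAll .A .W ;; .push .E (fun _ => none) ;; moveOnes .S .E,
    10 * X + 10, fun a rest N hN => ?_⟩
  have e10 : eval N (10 : Polynomial ℕ) = 10 := eval_natCast (n := 10)
  rw [eval_add, eval_mul, e10, eval_X]
  refine ⟨by dsimp only; omega, fun r s y => ?_⟩
  set w := inp a with hw
  have s1 := Run.push .S none ⟨w, sta a, [], env a rest, r, s, y⟩
  have s2 := Run.loop (k := .W) (c := Option.isSome)
    (p := .push .A (fun v => v.getD none) ;; .push .S fun _ => some true)
    (fun i => ⟨w.drop (w.length - i), sta a, (w.take (w.length - i)).reverse, env a rest, r,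
      ones (w.length - i) (none :: s), y⟩) w.length 2 (by simp [Mem.get])
      (fun i hi => by simp [Mem.get, drop_sub _ hi]) (fun i hi => by
        rw [ones_sub hi, drop_sub _ hi, take_sub _ hi]
        exact ⟨_, (Runs.push .A _ _ _).seq (Runs.push .S _ _ _)⟩)
  simp only [Nat.sub_self, Nat.sub_zero, List.take_length, List.drop_length, List.drop_zero,
    List.take_zero, List.reverse_nil] at s2
  have s3 := Run.moveAll (k₁ := .A) (k₂ := .W) (by decide)
    ⟨[], sta a, w.reverse, env a rest, r, ones w.length (none :: s), y⟩
  have e : (Mem.get ⟨[], sta a, w.reverse, env a rest, r, ones w.length (none :: s), y⟩ .A).reverse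
      ++ Mem.get ⟨[], sta a, w.reverse, env a rest, r, ones w.length (none :: s), y⟩ .W = w := by
    simp [Mem.get]
  have e' : (Mem.get ⟨[], sta a, w.reverse, env a rest, r, ones w.length (none :: s), y⟩
      .A).length = w.length := by
    simp [Mem.get]
  rw [e, e'] at s3
  have s4 := Run.push .E none ⟨w, sta a, [], env a rest, r, ones w.length (none :: s), y⟩
  have s5 := Run.moveOnes (k₁ := .S) (k₂ := .E) (by decide)
    (m := ⟨w, sta a, [], none :: env a rest, r, ones w.length (none :: s), y⟩)
    (n := w.length) (l := none :: s) rfl rfl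
  exact (s1.seq (s2.seq (s3.seq (s4.seq s5)))).mono (by omega)

/-- Move the top symbol of `k₁`, if there is one, to `k₂`. -/
def moveOne (k₁ k₂ : Stk) : Prog :=
  .pop k₁ ;; .ite Option.isSome (.push k₂ fun v => v.getD none) .skip

theorem Runs.moveOne (k₁ k₂ : Stk) (v : Option Sym) (m : Mem) :
    Runs (moveOne k₁ k₂) (v, m) ((m.get k₁).head?,
      (m.pop k₁).set ((m.get k₁).head?.toList ++ (m.pop k₁).get k₂) k₂) 3 := by
  refine (Runs.pop k₁ v m).seq (t' := 2) ?_
  cases h : (m.get k₁).head? with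
  | none =>
    convert! Runs.ite_false (c := Option.isSome) (v := none) rfl (.skip _) using 2
    apply Mem.ext_get
    intro k
    simp only [Mem.get_set]
    split_ifs <;> simp_all
  | some x => exact .ite_true rfl (.push k₂ _ _ _)

theorem Run.moveOne (k₁ k₂ : Stk) (m : Mem) : Run (moveOne k₁ k₂) m
    ((m.pop k₁).set ((m.get k₁).head?.toList ++ (m.pop k₁).get k₂) k₂) 3 :=
  fun v => ⟨_, Runs.moveOne k₁ k₂ v m⟩

theorem Run.congr {p : Prog} {m m' m₁ m₁' : Mem} {t : ℕ} (h : Run p m m' t) (e : m = m₁)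
    (e' : m' = m₁') : Run p m₁ m₁' t := by
  subst e e'
  exact h

/-- Replace the number `n` on the stack `E` by `1` or `0`, according to whether the symbol at
position `n` of the stack `k` satisfies `c`. -/
def readAt (k : Stk) (c : Option Sym → Bool) : Prog :=
  loop .E isTrue (moveOne k .A) ;;
  (moveOne k k ;; .push .E (fun _ => none) ;; .ite c (.push .E fun _ => some true) .skip) ;;
  moveAll .A k

/-- The first `n` symbols are moved to `A`, the next one is popped and pushed back, so that it is
only inspected, and `A` is poured back. Past the end of the word the moves do nothing and the
inspected value is `none`, in agreement with `[n]?`. -/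
theorem Run.readAt {k : Stk} (c : Option Sym → Bool) (hk : k = .W ∨ k = .X) {m : Mem} {n : ℕ}
    {e : List Sym} (hE : m.E = num n e) (hA : m.A = []) :
    Run (readAt k c) m (m.set (num (if c (m.get k)[n]? then 1 else 0) e) .E)
      (8 * n + 12) := by
  have hkE : k ≠ .E := by rcases hk with rfl | rfl <;> decide
  have hkA : k ≠ .A := by rcases hk with rfl | rfl <;> decide
  have hE' : m.get .E = num n e := hE
  have hA' : m.get .A = [] := hA
  clear hk hE hA
  obtain ⟨l, hl⟩ : ∃ l, m.get k = l := ⟨_, rfl⟩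
  rw [hl]
  have s1 := Run.loop (k := .E) (c := isTrue) (p := TopKVoting.moveOne k .A)
    (fun i => ((m.set (num i e) .E).set (l.drop (n - i)) k).set (l.take (n - i)).reverse .A) n 3
    (by simp [Mem.get_set, hkE.symm, num, ones])
    (fun i hi => by simp [Mem.get_set, hkE.symm, num, ones])
    (fun i hi => by
      obtain ⟨j, hj⟩ : ∃ j, n - (i + 1) = j := ⟨_, rfl⟩
      have hj' : n - i = j + 1 := by omega
      simp only [hj, hj']
      have hr : l[j]?.toList.reverse = l[j]?.toList := by cases l[j]? <;> rfl
      refine (Run.moveOne k .A _).congr rfl ?_ _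
      apply Mem.ext_get
      intro k'
      simp only [Mem.get_set, List.take_add_one]
      split_ifs <;> simp_all [num, ones, List.head?_drop])
  simp only [Nat.sub_self, Nat.sub_zero] at s1
  have s2 : Run (TopKVoting.moveOne k k ;; .push .E (fun _ => none) ;; .ite c (.push .E fun _ => some true)
      .skip) (((m.set e .E).set (l.drop n) k).set (l.take n).reverse .A)
      (((m.set (num (if c l[n]? then 1 else 0) e) .E).set (l.drop n) k).set
        (l.take n).reverse .A) 6 := by
    intro v
    refine ⟨l[n]?, (Runs.moveOne k k v _).seq ((Runs.push .E _ _ _).seq (t' := 2) ?_)⟩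
    have hh : (Mem.get (((m.set e .E).set (l.drop n) k).set (l.take n).reverse .A) k).head? =
        l[n]? := by
      simp [Mem.get_set, hkA, List.head?_drop]
    have hd : l[n]?.toList ++ l.drop (n + 1) = l.drop n := by
      rw [← List.tail_drop, ← List.head?_drop]
      cases l.drop n <;> rfl
    rw [hh]
    clear s1 hh
    cases hc : c l[n]? with
    | false =>
      convert! Runs.ite_false hc (.skip _) using 2
      apply Mem.ext_get
      intro k'
      simp only [Mem.get_set]
      split_ifs <;> simp_all [num, ones]
    | true =>
      convert! Runs.ite_true hc (.push .E _ _ _) using 2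
      apply Mem.ext_get
      intro k'
      simp only [Mem.get_set]
      split_ifs <;> simp_all [num, ones]
  have s3 := Run.moveAll (k₁ := .A) (k₂ := k) hkA
    (((m.set (num (if c l[n]? then 1 else 0) e) .E).set (l.drop n) k).set (l.take n).reverse .A)
  have s4 := s1.seq ((s2.congr ?_ rfl).seq s3)
  · refine (s4.mono (t' := 8 * n + 12) ?_).congr ?_ ?_
    · have : (l.take n).reverse.length ≤ n := by simp
      simp only [Mem.get_set, if_true]
      omega
    all_goals
      apply Mem.ext_get
      intro k'
      simp only [Mem.get_set]
      split_ifs <;> simp_all [num, ones]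
  · apply Mem.ext_get
    intro k'
    simp only [Mem.get_set]
    split_ifs <;> simp_all [num, ones]

theorem PT.readAt_inp {f : α → ℕ} (hf : PT f) (c : Option Sym → Bool) :
    PT fun a => if c (inp a)[f a]? then 1 else 0 := by
  obtain ⟨p, P, h⟩ := hf
  refine ⟨p ;; readAt .W c, 9 * P + 12, fun a rest N hN => ?_⟩
  obtain ⟨h1, h2⟩ := h a rest N hN
  have e9 : eval N (9 : Polynomial ℕ) = 9 := eval_natCast (n := 9)
  have e12 : eval N (12 : Polynomial ℕ) = 12 := eval_natCast (n := 12)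
  rw [eval_add, eval_mul, e9, e12]
  refine ⟨by dsimp only; split_ifs <;> omega, fun r s y => ?_⟩
  exact ((h2 r s y).seq (Run.readAt c (Or.inl rfl) rfl rfl)).mono (by omega)

theorem PT.readAt_sta {f : α → ℕ} (hf : PT f) (c : Option Sym → Bool) :
    PT fun a => if c (sta a)[f a]? then 1 else 0 := by
  obtain ⟨p, P, h⟩ := hf
  refine ⟨p ;; readAt .X c, 9 * P + 12, fun a rest N hN => ?_⟩
  obtain ⟨h1, h2⟩ := h a rest N hN
  have e9 : eval N (9 : Polynomial ℕ) = 9 := eval_natCast (n := 9)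
  have e12 : eval N (12 : Polynomial ℕ) = 12 := eval_natCast (n := 12)
  rw [eval_add, eval_mul, e9, e12]
  refine ⟨by dsimp only; split_ifs <;> omega, fun r s y => ?_⟩
  exact ((h2 r s y).seq (Run.readAt c (Or.inr rfl) rfl rfl)).mono (by omega)

end PT

/-! ### Iterated updates of a word in polynomial time -/

open Classical in
/-- The indicator of a proposition. -/
noncomputable def ind (p : Prop) : ℕ := if p then 1 else 0

/-- `p` is decided in polynomial time, numbers being written in unary. -/
def PTP {α : Type} [Ctx α] (p : α → Prop) : Prop := PT fun a => ind (p a)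

open Classical in
/-- The state after some rounds: a word of length `size w` whose letter at position `j` is
computed by `φ` from the preceding state. -/
noncomputable def iterState (size : List Sym → ℕ) (φ : Tapes × ℕ → Prop) (w : List Sym) :
    ℕ → List Sym
  | 0 => []
  | t + 1 => (List.range (size w)).map fun j => some (decide (φ (⟨w, iterState size φ w t⟩, j)))

theorem length_iterState_le (size : List Sym → ℕ) (φ : Tapes × ℕ → Prop) (w : List Sym) (t : ℕ) :
    (iterState size φ w t).length ≤ size w := by
  cases t <;> simp [iterState]

/-- Push the bit on top of `E` on the stack `Y`. -/
def storeBit : Prog :=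
  .pop .E ;; .push .Y (fun v => some (isTrue v)) ;; .ite isTrue (.pop .E) .skip

theorem Run.storeBit (p : Prop) [Decidable p] (w x a e r s y : List Sym) :
    Run storeBit ⟨w, x, a, num (ind p) e, r, s, y⟩ ⟨w, x, a, e, r, s, some (decide p) :: y⟩ 4 := by
  intro v
  by_cases hp : p
  · simp only [ind, hp, if_true, decide_true]
    exact ⟨_, (Runs.pop .E _ _).seq ((Runs.push .Y _ _ _).seq (.ite_true rfl (.pop .E _ _)))⟩
  · simp only [ind, hp, if_false, decide_false]
    exact ⟨_, (Runs.pop .E _ _).seq ((Runs.push .Y _ _ _).seq (.ite_false rfl (.skip _)))⟩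

/-- Given programs for the size and the update, compute the next state. -/
def updateState (pn pφ : Prog) : Prog :=
  pn ;; .push .S (fun _ => none) ;; moveOnes .E .S ;; .push .E (fun _ => none) ;;
  loop .S isTrue (pφ ;; storeBit ;; .push .E fun _ => some true) ;;
  dropOnes .E ;; clear .X ;; moveAll .Y .X

open Classical in
theorem Run.updateState {pn pφ : Prog} {w x : List Sym} {n t t' : ℕ} {φ : ℕ → Prop}
    (hn : ∀ r s y, Run pn ⟨w, x, [], [], r, s, y⟩ ⟨w, x, [], num n [], r, s, y⟩ t)
    (hφ : ∀ j < n, ∀ r s y, Run pφ ⟨w, x, [], num j [], r, s, y⟩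
      ⟨w, x, [], num (ind (φ j)) (num j []), r, s, y⟩ t') (r : List Sym) :
    Run (updateState pn pφ) ⟨w, x, [], [], r, [], []⟩
      ⟨w, (List.range n).map fun j => some (decide (φ j)), [], [], r, [], []⟩
      (t + n * (t' + 7) + 9 * n + 3 * x.length + 12) := by
  set b : ℕ → Sym := fun j => some (decide (φ j)) with hb
  have s1 := hn r [] []
  have s2 := Run.push .S none ⟨w, x, [], num n [], r, [], []⟩
  have s3 := Run.moveOnes (k₁ := .E) (k₂ := .S) (by decide)
    (m := ⟨w, x, [], num n [], r, [none], []⟩) (n := n) (l := [none]) rfl rfl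
  have s4 := Run.push .E none ⟨w, x, [], [], r, num n [], []⟩
  have s5 := Run.loop (k := .S) (c := isTrue)
    (p := pφ ;; TopKVoting.storeBit ;; .push .E fun _ => some true)
    (fun i => ⟨w, x, [], num (n - i) [], r, num i [], ((List.range (n - i)).map b).reverse⟩)
    n (t' + 5) rfl (fun i hi => rfl) (fun i hi => by
      obtain ⟨j, hj⟩ : ∃ j, n - (i + 1) = j := ⟨_, rfl⟩
      have hj' : n - i = j + 1 := by omega
      rw [hj, hj', List.range_succ, List.map_append, List.reverse_append]
      have t1 := hφ j (by omega) r (num i []) ((List.range j).map b).reverse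
      have t2 := Run.storeBit (φ j) w x [] (num j []) r (num i []) ((List.range j).map b).reverse
      have t3 := Run.push .E (some true)
        ⟨w, x, [], num j [], r, num i [], b j :: ((List.range j).map b).reverse⟩
      exact (t1.seq (t2.seq t3)).mono (t' := t' + 5) (by omega) _)
  simp only [Nat.sub_self, Nat.sub_zero] at s5
  have s6 := Run.dropOnes (k := .E) (m := ⟨w, x, [], num n [], r, [], ((List.range n).map b).reverse⟩)
    (n := n) (l := [none]) rfl rfl
  have s7 := Run.clear (k := .X) ⟨w, x, [], [], r, [], ((List.range n).map b).reverse⟩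
  have s8 := Run.moveAll (k₁ := .Y) (k₂ := .X) (by decide)
    ⟨w, [], [], [], r, [], ((List.range n).map b).reverse⟩
  have e1 : (Mem.get ⟨w, [], [], [], r, [], ((List.range n).map b).reverse⟩ .Y).length = n := by
    simp [Mem.get]
  have e2 : (Mem.get ⟨w, [], [], [], r, [], ((List.range n).map b).reverse⟩ .Y).reverse ++
      Mem.get ⟨w, [], [], [], r, [], ((List.range n).map b).reverse⟩ .X = (List.range n).map b := by
    simp [Mem.get]
  have e3 : (Mem.get ⟨w, x, [], [], r, [], ((List.range n).map b).reverse⟩ .X).length =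
    x.length := rfl
  rw [e1, e2] at s8
  rw [e3] at s7
  refine (s1.seq (s2.seq (s3.seq (s4.seq (s5.seq (s6.seq (s7.seq s8))))))).mono ?_
  have : n * (t' + 5 + 2) = n * (t' + 7) := by ring
  omega

/-- Leave the bit on top of `E` as the last popped symbol, with all stacks empty. -/
def finish : Prog :=
  clear .W ;; clear .X ;; .pop .E ;; .push .A (fun v => v.getD none) ;;
  .whl isTrue (.pop .E) ;; .pop .A

theorem Runs.finish (p : Prop) (w x : List Sym) (v : Option Sym) :
    ∃ v', Runs finish (v, ⟨w, x, [], num (ind p) [], [], [], []⟩) (v', Mem.empty)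
      (3 * w.length + 3 * x.length + 10) ∧ (v' = some (some true) ↔ p) := by
  obtain ⟨v1, h1⟩ := Run.clear (k := .W) ⟨w, x, [], num (ind p) [], [], [], []⟩ v
  obtain ⟨v2, h2⟩ := Run.clear (k := .X) ⟨[], x, [], num (ind p) [], [], [], []⟩ v1
  have e1 : (Mem.get ⟨w, x, [], num (ind p) [], [], [], []⟩ .W).length = w.length := rfl
  have e2 : (Mem.get ⟨[], x, [], num (ind p) [], [], [], []⟩ .X).length = x.length := rfl
  rw [e1] at h1
  rw [e2] at h2
  by_cases hp : p
  · have e : num (ind p) [] = [some true, none] := by simp [ind, hp, num, ones]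
    rw [e] at h1 h2 ⊢
    have h := h1.seq (h2.seq ((Runs.pop .E _ _).seq ((Runs.push .A (fun v => v.getD none) _ _).seq
      ((Runs.whl_true (c := isTrue) rfl (.pop .E _ _) (.whl_false (c := isTrue) rfl)).seq (.pop .A _ _)))))
    exact ⟨some (some true), h.mono (by omega), by simp [hp]⟩
  · have e : num (ind p) [] = [none] := by simp [ind, hp, num, ones]
    rw [e] at h1 h2 ⊢
    have h := h1.seq (h2.seq ((Runs.pop .E _ _).seq ((Runs.push .A (fun v => v.getD none) _ _).seq
      ((Runs.whl_false (c := isTrue) (p := .pop .E) rfl).seq (.pop .A _ _)))))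
    exact ⟨some none, h.mono (by omega), by simp [hp]⟩

open Polynomial in
/-- A problem that is solved by polynomially many rounds of a simple update is solvable in
polynomial time. -/
theorem solvableInPolynomialTime_of_iterState {β : Type} {enc : β → List (Option Bool)}
    {L : β → Prop} {size rounds : List Sym → ℕ} {φ : Tapes × ℕ → Prop} {ψ : Tapes → Prop}
    (hsize : PT fun d : Tapes => size d.inp) (hrounds : PT fun d : Tapes => rounds d.inp)
    (hφ : PTP φ) (hψ : PTP ψ)
    (h : ∀ a, L a ↔ ψ ⟨enc a, iterState size φ (enc a) (rounds (enc a))⟩) :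
    SolvableInPolynomialTime enc L := by
  obtain ⟨pn, Pn, hn⟩ := hsize
  obtain ⟨pt, Pt, ht⟩ := hrounds
  obtain ⟨pφ, Pφ, hφ⟩ := hφ
  obtain ⟨pψ, Pψ, hψ⟩ := hψ
  -- `M` bounds the total length of input and state in every round, since a state never exceeds
  -- `size w`. `U` bounds one update; there the argument `M + Pn + 1` leaves room for the unary
  -- position of the letter being computed.
  set M : Polynomial ℕ := X + Pn with hM
  set U : Polynomial ℕ := Pn.comp M + Pn * (Pφ.comp (M + Pn + 1) + 7) + 12 * Pn + 12 with hU
  refine solvableInPolynomialTime_of_prog enc L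
    (pt ;; .push .R (fun _ => none) ;; moveOnes .E .R ;;
      loop .R isTrue (updateState pn pφ) ;; pψ ;; finish)
    (4 * Pt + Pt * (U + 2) + Pψ.comp M + 3 * X + 3 * Pn + 20) fun a => ?_
  set w := enc a with hw
  have e3 : eval w.length (3 : Polynomial ℕ) = 3 := eval_natCast (n := 3)
  have e4 : eval w.length (4 : Polynomial ℕ) = 4 := eval_natCast (n := 4)
  have e2 : eval w.length (2 : Polynomial ℕ) = 2 := eval_natCast (n := 2)
  have e7 : eval w.length (7 : Polynomial ℕ) = 7 := eval_natCast (n := 7)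
  have e12 : eval w.length (12 : Polynomial ℕ) = 12 := eval_natCast (n := 12)
  have e20 : eval w.length (20 : Polynomial ℕ) = 20 := eval_natCast (n := 20)
  obtain ⟨τ, hτ⟩ : ∃ τ, rounds w = τ := ⟨_, rfl⟩
  obtain ⟨n, hnw⟩ : ∃ n, size w = n := ⟨_, rfl⟩
  have hnle : n ≤ Pn.eval w.length := by
    have := (hn ⟨w, []⟩ [] w.length (by simp [env, nums, Ctx.vars, Ctx.inp, Ctx.sta])).1
    change size w ≤ _ at this
    rwa [hnw] at this
  have hx : ∀ t, (iterState size φ w t).length ≤ n := fun t => by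
    rw [← hnw]
    exact length_iterState_le size φ w t
  have hMe : M.eval w.length = w.length + Pn.eval w.length := by simp [hM]
  obtain ⟨hτ1, hτ2⟩ := ht ⟨w, []⟩ [] w.length (by simp [env, nums, Ctx.vars, Ctx.inp, Ctx.sta])
  simp only [hτ] at hτ1 hτ2
  have hstep : ∀ t r, Run (updateState pn pφ) ⟨w, iterState size φ w t, [], [], r, [], []⟩
      ⟨w, iterState size φ w (t + 1), [], [], r, [], []⟩ (U.eval w.length) := by
    intro t r
    have a1 := (hn ⟨w, iterState size φ w t⟩ [] (M.eval w.length) (by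
      have := hx t
      simp only [env, nums, Ctx.vars, Ctx.inp, Ctx.sta, List.foldr_nil, List.length_nil]
      omega)).2
    simp only [hnw] at a1
    have a2 := fun j (hj : j < n) => (hφ (⟨w, iterState size φ w t⟩, j) [] ((M + Pn + 1).eval w.length) (by
      have := hx t
      simp only [env, nums, Ctx.vars, Ctx.inp, Ctx.sta, List.foldr_nil, List.foldr_cons,
        length_num, List.length_nil, eval_add, eval_one]
      omega)).2
    have := Run.updateState a1 a2 r
    simp only [iterState, hnw]
    refine this.mono ?_
    have h5 : n * (eval (eval w.length (M + Pn + 1)) Pφ + 7) ≤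
      eval w.length Pn * (eval (eval w.length (M + Pn + 1)) Pφ + 7) := Nat.mul_le_mul_right _ hnle
    have h6 : (Ctx.sta (Tapes.mk w (iterState size φ w t))).length ≤ n := hx t
    simp only [hU, eval_add, eval_mul, eval_comp, e7, e12] at h5 ⊢
    omega
  have hloop := Run.loop (k := .R) (c := isTrue) (p := updateState pn pφ)
    (fun i => ⟨w, iterState size φ w (τ - i), [], [], num i [], [], []⟩) τ (U.eval w.length)
    rfl (fun i hi => rfl) (fun i hi => by
      obtain ⟨j, hj⟩ : ∃ j, τ - (i + 1) = j := ⟨_, rfl⟩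
      have hj' : τ - i = j + 1 := by omega
      rw [hj, hj']
      exact hstep j (num i []) _)
  simp only [Nat.sub_self, Nat.sub_zero] at hloop
  have s1 := hτ2 [] [] []
  have s2 := Run.push .R none ⟨w, [], [], num τ [], [], [], []⟩
  have s3 := Run.moveOnes (k₁ := .E) (k₂ := .R) (by decide)
    (m := ⟨w, [], [], num τ [], [none], [], []⟩) (n := τ) (l := [none]) rfl rfl
  have s5 := (hψ ⟨w, iterState size φ w τ⟩ [] (M.eval w.length) (by
      have := hx τ
      simp only [env, nums, Ctx.vars, Ctx.inp, Ctx.sta, List.foldr_nil, List.length_nil]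
      omega)).2 [] [] []
  obtain ⟨v1, r1⟩ := s1 none
  obtain ⟨v2, r2⟩ := s2 v1
  obtain ⟨v3, r3⟩ := s3 v2
  obtain ⟨v4, r4⟩ := hloop v3
  obtain ⟨v5, r5⟩ := s5 v4
  obtain ⟨v6, r6, hv6⟩ := Runs.finish (ψ ⟨w, iterState size φ w τ⟩) w (iterState size φ w τ) v5
  refine ⟨v6, (r1.seq (r2.seq (r3.seq (r4.seq (r5.seq r6))))).mono ?_, ?_⟩
  · have h5 : τ * (eval w.length U + 2) ≤ eval w.length Pt * (eval w.length U + 2) :=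
      Nat.mul_le_mul_right _ hτ1
    have h6 := hx τ
    simp only [eval_add, eval_mul, eval_comp, e2, e3, e4, e20, eval_X]
    omega
  · rw [hv6, h a, ← hw, hτ]

/-! ### Bipartite matching by an auction -/

section Auction

variable (Q : ℕ) (act : ℕ → Prop) (adj : ℕ → ℕ → Prop)

/-- The bipartite graph `adj` on two copies of `{0, …, Q - 1}` has a matching that covers all
vertices `a` of the left side with `act a`. -/
def Saturable : Prop :=
  ∃ μ : ℕ → ℕ, (∀ a < Q, act a → μ a < Q ∧ adj a (μ a)) ∧
    ∀ a < Q, ∀ a' < Q, act a → act a' → μ a = μ a' → a = a'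

/-- The least active vertex that is not matched. -/
def FirstFree (M : ℕ → ℕ → Prop) (a : ℕ) : Prop :=
  act a ∧ (¬ ∃ b < Q, M a b) ∧ ∀ a' < a, act a' → ∃ b < Q, M a' b

/-- In the next round, `a` is matched with `b`, a neighbour with the least label. -/
def Chosen (M : ℕ → ℕ → Prop) (lab : ℕ → ℕ) (a b : ℕ) : Prop :=
  FirstFree Q act M a ∧ adj a b ∧ ∀ b' < Q, adj a b' → lab b * Q + b ≤ lab b' * Q + b'

def Hit (M : ℕ → ℕ → Prop) (lab : ℕ → ℕ) (b : ℕ) : Prop :=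
  ∃ a < Q, Chosen Q act adj M lab a b

/-- The matching after the next round. -/
def nextMatch (M : ℕ → ℕ → Prop) (lab : ℕ → ℕ) (a b : ℕ) : Prop :=
  Chosen Q act adj M lab a b ∨ (M a b ∧ ¬ Hit Q act adj M lab b)

open Classical in
/-- The labels after the next round. -/
noncomputable def nextLab (M : ℕ → ℕ → Prop) (lab : ℕ → ℕ) (b : ℕ) : ℕ :=
  if Hit Q act adj M lab b then min (lab b + 1) Q else lab b

/-- The invariant of the auction. -/
structure AuctionInv (M : ℕ → ℕ → Prop) (lab : ℕ → ℕ) : Prop where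
  act_of : ∀ a < Q, ∀ b < Q, M a b → act a ∧ adj a b
  right_unique : ∀ a < Q, ∀ b < Q, ∀ b' < Q, M a b → M a b' → b = b'
  left_unique : ∀ a < Q, ∀ a' < Q, ∀ b < Q, M a b → M a' b → a = a'
  exists_of_pos : ∀ b < Q, 0 < lab b → ∃ a < Q, M a b
  lab_le : ∀ a < Q, ∀ b < Q, ∀ b' < Q, M a b → adj a b' → lab b ≤ lab b' + 1
  lab_le_size : ∀ b < Q, lab b ≤ Q

variable {Q act adj} {M : ℕ → ℕ → Prop} {lab : ℕ → ℕ}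

/-- The least free vertex is unique. Two minimal keys `lab b * Q + b` are equal, and their residues
modulo `Q` recover `b`: the key breaks ties between labels by the index. -/
theorem Chosen.unique {a a' b b' : ℕ} (hb : b < Q) (hb' : b' < Q)
    (h : Chosen Q act adj M lab a b) (h' : Chosen Q act adj M lab a' b') : a = a' ∧ b = b' := by
  obtain ⟨⟨h1, h2, h3⟩, h4, h5⟩ := h
  obtain ⟨⟨h1', h2', h3'⟩, h4', h5'⟩ := h'
  have ha : a = a' := by
    rcases lt_trichotomy a a' with h | h | h
    · exact absurd (h3' a h h1) h2
    · exact h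
    · exact absurd (h3 a' h h1') h2'
  subst ha
  have he : lab b * Q + b = lab b' * Q + b' := le_antisymm (h5 b' hb' h4') (h5' b hb h4)
  have := congrArg (· % Q) he
  simp only [Nat.mul_add_mod_self_right, Nat.mod_eq_of_lt hb, Nat.mod_eq_of_lt hb'] at this
  exact ⟨rfl, this⟩

theorem lab_le_of_key_le {b b' : ℕ} (hb' : b' < Q) (h : lab b * Q + b ≤ lab b' * Q + b') :
    lab b ≤ lab b' := by
  by_contra! hlt
  have : (lab b' + 1) * Q ≤ lab b * Q := Nat.mul_le_mul_right _ hlt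
  rw [Nat.succ_mul] at this
  omega

theorem AuctionInv.lab_le_nextLab (h : AuctionInv Q act adj M lab) {b : ℕ} (hb : b < Q) :
    lab b ≤ nextLab Q act adj M lab b := by
  have := h.lab_le_size b hb
  unfold nextLab
  split_ifs <;> omega

theorem AuctionInv.init : AuctionInv Q act adj (fun _ _ => False) fun _ => 0 where
  act_of _ _ _ _ h := h.elim
  right_unique _ _ _ _ _ _ h := h.elim
  left_unique _ _ _ _ _ _ h := h.elim
  exists_of_pos _ _ h := (lt_irrefl _ h).elim
  lab_le _ _ _ _ _ _ h := h.elim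
  lab_le_size _ _ := Nat.zero_le _

/-- A right vertex that is hit only changes its partner, so a vertex with positive label stays
matched. For `lab_le`, a newly chosen vertex had the least label among the neighbours and rises by
at most one; an old pair keeps its label while all other labels can only grow. -/
theorem AuctionInv.next (h : AuctionInv Q act adj M lab) :
    AuctionInv Q act adj (nextMatch Q act adj M lab) (nextLab Q act adj M lab) where
  act_of a ha b hb := by
    rintro (hc | ⟨hm, _⟩)
    · exact ⟨hc.1.1, hc.2.1⟩
    · exact h.act_of a ha b hb hm
  right_unique a ha b hb b' hb' := by
    rintro (hc | ⟨hm, _⟩) (hc' | ⟨hm', _⟩)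
    · exact (hc.unique hb hb' hc').2
    · exact absurd ⟨b', hb', hm'⟩ hc.1.2.1
    · exact absurd ⟨b, hb, hm⟩ hc'.1.2.1
    · exact h.right_unique a ha b hb b' hb' hm hm'
  left_unique a ha a' ha' b hb := by
    rintro (hc | ⟨hm, hh⟩) (hc' | ⟨hm', hh'⟩)
    · exact (hc.unique hb hb hc').1
    · exact absurd ⟨a, ha, hc⟩ hh'
    · exact absurd ⟨a', ha', hc'⟩ hh
    · exact h.left_unique a ha a' ha' b hb hm hm'
  exists_of_pos b hb hpos := by
    by_cases hh : Hit Q act adj M lab b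
    · obtain ⟨a, ha, hc⟩ := hh
      exact ⟨a, ha, Or.inl hc⟩
    · rw [nextLab, if_neg hh] at hpos
      obtain ⟨a, ha, hm⟩ := h.exists_of_pos b hb hpos
      exact ⟨a, ha, Or.inr ⟨hm, hh⟩⟩
  lab_le a ha b hb b' hb' := by
    have h1 := h.lab_le_nextLab hb'
    rintro (hc | ⟨hm, hh⟩) hadj
    · have h2 := lab_le_of_key_le hb' (hc.2.2 b' hb' hadj)
      rw [nextLab, if_pos ⟨a, ha, hc⟩]
      omega
    · have h2 := h.lab_le a ha b hb b' hb' hm hadj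
      rw [nextLab, if_neg hh]
      omega
  lab_le_size b hb := by
    have := h.lab_le_size b hb
    unfold nextLab
    split_ifs <;> omega

/-- If all neighbours of a free vertex have the largest label, then Hall's condition fails. -/
theorem AuctionInv.not_saturable (h : AuctionInv Q act adj M lab) {a₀ : ℕ} (ha₀ : a₀ < Q)
    (hact : act a₀) (hfree : ¬ ∃ b < Q, M a₀ b) (hlab : ∀ b < Q, adj a₀ b → Q ≤ lab b) :
    ¬ Saturable Q act adj := by
  classical
  rintro ⟨μ, hμ, hinj⟩
  obtain ⟨hμ₀, hadj₀⟩ := hμ a₀ ha₀ hact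
  have hlab₀ := hlab _ hμ₀ hadj₀
  -- Pigeonhole: the label of `μ a₀` is at least `Q`, so at most `Q - 1` right vertices have labels
  -- among the `Q` values below `Q`.
  obtain ⟨j, hj, hjne⟩ : ∃ j < Q, ∀ b < Q, lab b ≠ j := by
    by_contra! hcon
    have hsub : Finset.range Q ⊆ ((Finset.range Q).erase (μ a₀)).image lab := by
      intro j hj
      obtain ⟨b, hb, rfl⟩ := hcon j (Finset.mem_range.1 hj)
      refine Finset.mem_image_of_mem _ (Finset.mem_erase.2 ⟨?_, Finset.mem_range.2 hb⟩)
      rintro rfl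
      have := Finset.mem_range.1 hj
      omega
    have h1 := (Finset.card_le_card hsub).trans Finset.card_image_le
    rw [Finset.card_erase_of_mem (Finset.mem_range.2 hμ₀), Finset.card_range] at h1
    omega
  -- All of `Z` is matched. A neighbour of a partner of `Z` has label at least `j` by `lab_le`, and
  -- `j` is not attained, so it lies in `Z` again; the neighbours of `a₀` lie in `Z` too. Hence `μ`
  -- would inject `Z.card + 1` vertices into `Z`.
  set Z := (Finset.range Q).filter fun b => j < lab b with hZ
  have hg : ∀ b ∈ Z, ∃ a < Q, M a b := fun b hb => by
    obtain ⟨h1, h2⟩ := Finset.mem_filter.1 hb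
    exact h.exists_of_pos b (Finset.mem_range.1 h1) (by omega)
  choose! g hgQ hgM using hg
  have hZQ : ∀ b ∈ Z, b < Q := fun b hb => Finset.mem_range.1 (Finset.mem_filter.1 hb).1
  have hnot : a₀ ∉ Z.image g := by
    intro hmem
    obtain ⟨b, hb, rfl⟩ := Finset.mem_image.1 hmem
    exact hfree ⟨b, hZQ b hb, hgM b hb⟩
  have hginj : Set.InjOn g Z := by
    intro b hb b' hb' e
    have h1 := hgM b hb
    rw [e] at h1
    exact h.right_unique _ (hgQ b' hb') b (hZQ b hb) b' (hZQ b' hb') h1 (hgM b' hb')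
  have hcard : (insert a₀ (Z.image g)).card = Z.card + 1 := by
    rw [Finset.card_insert_of_notMem hnot, Finset.card_image_of_injOn hginj]
  have hprop : ∀ a ∈ insert a₀ (Z.image g), a < Q ∧ act a ∧ μ a ∈ Z := by
    intro a ha
    rcases Finset.mem_insert.1 ha with rfl | ha
    · exact ⟨ha₀, hact, Finset.mem_filter.2 ⟨Finset.mem_range.2 hμ₀, by omega⟩⟩
    · obtain ⟨b, hb, rfl⟩ := Finset.mem_image.1 ha
      have h1 := (h.act_of _ (hgQ b hb) b (hZQ b hb) (hgM b hb)).1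
      obtain ⟨h2, h3⟩ := hμ _ (hgQ b hb) h1
      have h4 := h.lab_le _ (hgQ b hb) b (hZQ b hb) _ h2 (hgM b hb) h3
      have h5 := (Finset.mem_filter.1 hb).2
      have h6 := hjne _ h2
      exact ⟨hgQ b hb, h1, Finset.mem_filter.2 ⟨Finset.mem_range.2 h2, by omega⟩⟩
  have hle : (insert a₀ (Z.image g)).card ≤ Z.card :=
    Finset.card_le_card_of_injOn μ (fun a ha => (hprop a ha).2.2) fun a ha a' ha' e =>
      hinj a (hprop a ha).1 a' (hprop a' ha').1 (hprop a ha).2.1 (hprop a' ha').2.1 e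
  omega

variable (Q act adj)

/-- The matching and the labels after `t` rounds. -/
noncomputable def auction : ℕ → (ℕ → ℕ → Prop) × (ℕ → ℕ)
  | 0 => (fun _ _ => False, fun _ => 0)
  | t + 1 => (nextMatch Q act adj (auction t).1 (auction t).2,
      nextLab Q act adj (auction t).1 (auction t).2)

theorem auction_inv (t : ℕ) : AuctionInv Q act adj (auction Q act adj t).1 (auction Q act adj t).2 := by
  induction t with
  | zero => exact .init
  | succ t ih => exact ih.next

/-- All active vertices are matched after `t` rounds. -/
def AllMatched (t : ℕ) : Prop := ∀ a < Q, act a → ∃ b < Q, (auction Q act adj t).1 a b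

variable {Q act adj}

theorem AllMatched.saturable {t : ℕ} (h : AllMatched Q act adj t) : Saturable Q act adj := by
  choose! μ hμ hM using h
  have hinv := auction_inv Q act adj t
  refine ⟨μ, fun a ha hact => ⟨hμ a ha hact,
    (hinv.act_of a ha _ (hμ a ha hact) (hM a ha hact)).2⟩, fun a ha a' ha' hact hact' e => ?_⟩
  have h1 := hM a ha hact
  rw [e] at h1
  exact hinv.left_unique a ha a' ha' _ (hμ a' ha' hact') h1 (hM a' ha' hact')

/-- Without a free active vertex nothing is hit, so the matching is kept. -/
theorem AllMatched.succ {t : ℕ} (h : AllMatched Q act adj t) : AllMatched Q act adj (t + 1) := by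
  intro a ha hact
  obtain ⟨b, hb, hm⟩ := h a ha hact
  refine ⟨b, hb, Or.inr ⟨hm, ?_⟩⟩
  rintro ⟨a', ha', hc⟩
  exact hc.1.2.1 (h a' ha' hc.1.1)

/-- If a matching exists, `AuctionInv.not_saturable` gives the least free vertex a neighbour of
label below `Q`. The chosen label is then really raised, not cut off by the minimum with `Q`. -/
theorem sum_lab_lt (hs : Saturable Q act adj) {t : ℕ} (h : ¬ AllMatched Q act adj t) :
    ∑ b ∈ Finset.range Q, (auction Q act adj t).2 b <
      ∑ b ∈ Finset.range Q, (auction Q act adj (t + 1)).2 b := by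
  classical
  have hinv := auction_inv Q act adj t
  have hex : ∃ a, a < Q ∧ act a ∧ ¬ ∃ b < Q, (auction Q act adj t).1 a b := by
    unfold AllMatched at h
    push Not at h ⊢
    exact h
  obtain ⟨ha, hact, hfree⟩ := Nat.find_spec hex
  have hmin : ∀ a' < Nat.find hex, act a' → ∃ b < Q, (auction Q act adj t).1 a' b := by
    intro a' ha' hact'
    have := Nat.find_min hex ha'
    by_contra hcon
    exact this ⟨by omega, hact', hcon⟩
  generalize Nat.find hex = a at *
  have hfirst : FirstFree Q act (auction Q act adj t).1 a := ⟨hact, hfree, hmin⟩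
  obtain ⟨μ, hμ, hinj⟩ := id hs
  obtain ⟨b, hb, hbmin⟩ := Finset.exists_min_image ((Finset.range Q).filter fun b => adj a b)
    (fun b => (auction Q act adj t).2 b * Q + b)
    ⟨μ a, Finset.mem_filter.2 ⟨Finset.mem_range.2 (hμ a ha hact).1, (hμ a ha hact).2⟩⟩
  obtain ⟨hbQ, hadj⟩ := Finset.mem_filter.1 hb
  rw [Finset.mem_range] at hbQ
  have hmin' : ∀ b' < Q, adj a b' → (auction Q act adj t).2 b * Q + b ≤
      (auction Q act adj t).2 b' * Q + b' := fun b' hb' hadj' =>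
    hbmin b' (Finset.mem_filter.2 ⟨Finset.mem_range.2 hb', hadj'⟩)
  have hlt : (auction Q act adj t).2 b < Q := by
    by_contra! hge
    exact hinv.not_saturable ha hact hfree
      (fun b' hb' hadj' => hge.trans (lab_le_of_key_le hb' (hmin' b' hb' hadj'))) hs
  refine Finset.sum_lt_sum (fun b' hb' => hinv.lab_le_nextLab (Finset.mem_range.1 hb'))
    ⟨b, Finset.mem_range.2 hbQ, ?_⟩
  have hhit : Hit Q act adj (auction Q act adj t).1 (auction Q act adj t).2 b :=
    ⟨a, ha, hfirst, hadj, hmin'⟩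
  change _ < nextLab Q act adj _ _ b
  rw [nextLab, if_pos hhit]
  omega

/-- The auction decides whether there is a matching. -/
theorem allMatched_iff : AllMatched Q act adj (Q * Q + 1) ↔ Saturable Q act adj := by
  refine ⟨AllMatched.saturable, fun hs => ?_⟩
  by_contra hcon
  have hnot : ∀ t ≤ Q * Q + 1, ¬ AllMatched Q act adj t := by
    intro t ht hall
    exact hcon (Nat.le_induction hall (fun n _ ih => ih.succ) _ ht)
  -- Every unfinished round adds at least one to the sum of the labels, which cannot exceed `Q * Q`.
  have hsum : ∀ t ≤ Q * Q + 1, t ≤ ∑ b ∈ Finset.range Q, (auction Q act adj t).2 b := by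
    intro t
    induction t with
    | zero => exact fun _ => Nat.zero_le _
    | succ t ih =>
      intro ht
      have h1 := ih (by omega)
      have h2 := sum_lab_lt hs (hnot t (by omega))
      omega
  have h1 := hsum _ le_rfl
  have h2 : ∑ b ∈ Finset.range Q, (auction Q act adj (Q * Q + 1)).2 b ≤ Q * Q := by
    simpa using Finset.sum_le_card_nsmul (Finset.range Q) _ Q fun b hb =>
      (auction_inv Q act adj (Q * Q + 1)).lab_le_size b (Finset.mem_range.1 hb)
  omega

end Auction

/-! ### Closure properties -/

@[simp] theorem ind_true {p : Prop} (h : p) : ind p = 1 := if_pos h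

@[simp] theorem ind_false {p : Prop} (h : ¬ p) : ind p = 0 := if_neg h

theorem ind_le_one (p : Prop) : ind p ≤ 1 := by
  unfold ind
  split_ifs <;> simp

theorem ind_congr {p q : Prop} (h : p ↔ q) : ind p = ind q := by rw [propext h]

section Closure

variable {α : Type} [Ctx α] {f g : α → ℕ} {p q : α → Prop}

theorem PT.congr (hf : PT f) (h : ∀ a, f a = g a) : PT g := by
  rwa [← funext h]

theorem PTP.congr (hp : PTP p) (h : ∀ a, p a ↔ q a) : PTP q :=
  PT.congr hp fun a => ind_congr (h a)

theorem PTP.ind (hp : PTP p) : PT fun a => ind (p a) := hp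

theorem PT.mul (hf : PT f) (hg : PT g) : PT fun a => f a * g a :=
  (PT.sum hf (g := fun a _ => g a) hg.weaken).congr fun a => by simp

theorem PT.pow (hf : PT f) (n : ℕ) : PT fun a => f a ^ n := by
  induction n with
  | zero => exact (PT.const 1).congr fun a => by simp
  | succ n ih => exact (ih.mul hf).congr fun a => (pow_succ _ _).symm

theorem PTP.not (hp : PTP p) : PTP fun a => ¬ p a :=
  ((PT.const 1).sub hp).congr fun a => by by_cases h : p a <;> simp [h]

theorem PTP.and (hp : PTP p) (hq : PTP q) : PTP fun a => p a ∧ q a :=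
  (PT.mul hp hq).congr fun a => by by_cases h : p a <;> by_cases h' : q a <;> simp [h, h']

theorem PTP.or (hp : PTP p) (hq : PTP q) : PTP fun a => p a ∨ q a :=
  (hp.not.and hq.not).not.congr fun a => by tauto

theorem PTP.imp (hp : PTP p) (hq : PTP q) : PTP fun a => p a → q a :=
  (hp.and hq.not).not.congr fun a => by tauto

theorem PTP.le (hf : PT f) (hg : PT g) : PTP fun a => f a ≤ g a :=
  ((PT.const 1).sub (hf.sub hg)).congr fun a => by
    by_cases h : f a ≤ g a
    · simp [h]
    · rw [ind_false h]
      omega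

theorem PTP.lt (hf : PT f) (hg : PT g) : PTP fun a => f a < g a := PTP.le hf.succ hg

theorem PTP.eq (hf : PT f) (hg : PT g) : PTP fun a => f a = g a :=
  ((PTP.le hf hg).and (PTP.le hg hf)).congr fun _ => le_antisymm_iff.symm

theorem PTP.false : PTP fun _ : α => False :=
  PT.zero.congr fun a => by simp

/-- Witnesses are counted by a bounded sum, and the count is compared with zero. -/
theorem PTP.ex {r : α → ℕ → Prop} (hf : PT f) (hr : PTP fun a : α × ℕ => r a.1 a.2) :
    PTP fun a => ∃ i < f a, r a i :=
  (PTP.lt PT.zero (PT.sum (g := fun a i => TopKVoting.ind (r a i)) hf hr.ind)).congr fun a => by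
    rw [pos_iff_ne_zero, Ne, Finset.sum_eq_zero_iff]
    simp [TopKVoting.ind]

theorem PTP.all {r : α → ℕ → Prop} (hf : PT f) (hr : PTP fun a : α × ℕ => r a.1 a.2) :
    PTP fun a => ∀ i < f a, r a i :=
  (PTP.ex (r := fun a i => ¬ r a i) hf hr.not).not.congr fun a => by simp

theorem sum_ind_lt (n c : ℕ) : ∑ i ∈ Finset.range n, ind (i < c) = min n c := by
  induction n with
  | zero => simp
  | succ n ih =>
    rw [Finset.sum_range_succ, ih]
    by_cases h : n < c
    · rw [ind_true h]
      omega
    · rw [ind_false h]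
      omega

/-- The quotient is the number of positive multiples of `g a` up to `f a`; as the divisor is
positive, it suffices to test the first `f a` multiples. -/
theorem PT.div (hf : PT f) (hg : PT g) (h : ∀ a, 0 < g a) : PT fun a => f a / g a :=
  (PT.sum (g := fun a i => TopKVoting.ind ((i + 1) * g a ≤ f a)) hf
    (PTP.le (PT.var.succ.mul hg.weaken) hf.weaken).ind).congr fun a => by
    have : ∀ i, ((i + 1) * g a ≤ f a) ↔ i < f a / g a := fun i => by
      rw [← Nat.le_div_iff_mul_le (h a)]
      exact Nat.succ_le_iff
    simp only [this, sum_ind_lt]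
    exact min_eq_right (Nat.div_le_self _ _)

theorem PT.mod (hf : PT f) (hg : PT g) (h : ∀ a, 0 < g a) : PT fun a => f a % g a :=
  (hf.sub (hg.mul (hf.div hg h))).congr fun _ => (Nat.mod_def _ _).symm

theorem PTP.readAt_inp (hf : PT f) (s : Sym) : PTP fun a => (Ctx.inp a)[f a]? = some s :=
  (PT.readAt_inp hf fun v => decide (v = some s)).congr fun a => by
    by_cases h : (Ctx.inp a)[f a]? = some s <;> simp [h]

theorem PTP.readAt_sta (hf : PT f) (s : Sym) : PTP fun a => (Ctx.sta a)[f a]? = some s :=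
  (PT.readAt_sta hf fun v => decide (v = some s)).congr fun a => by
    by_cases h : (Ctx.sta a)[f a]? = some s <;> simp [h]

end Closure

/-- `F` is computed in polynomial time from the input word. -/
def PTInput (F : List Sym → ℕ) : Prop := ∀ {α : Type} [Ctx α], PT fun a : α => F (Ctx.inp a)

/-- `F` is decided in polynomial time from the input word and two numbers. -/
def PTInput₂ (F : List Sym → ℕ → ℕ → Prop) : Prop :=
  ∀ {α : Type} [Ctx α] {f g : α → ℕ}, PT f → PT g → PTP fun a => F (Ctx.inp a) (f a) (g a)

/-- `F` is decided in polynomial time from the input word and three numbers. -/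
def PTInput₃ (F : List Sym → ℕ → ℕ → ℕ → Prop) : Prop :=
  ∀ {α : Type} [Ctx α] {f g h : α → ℕ}, PT f → PT g → PT h →
    PTP fun a => F (Ctx.inp a) (f a) (g a) (h a)

/-! ### Auctions run in polynomial time -/

/-- The position of a bit of the state: `q` is the number of vertices, `code` the number of the
graph, `tag` distinguishes the matching from the labels. -/
def bitIndex (q code tag x y : ℕ) : ℕ := ((code * 2 + tag) * q + x) * q + y

def bit (s : List Sym) (q code tag x y : ℕ) : Prop := s[bitIndex q code tag x y]? = some (some true)

/-- The matching stored in the state. -/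
def storedMatch (s : List Sym) (q code : ℕ) (a b : ℕ) : Prop := bit s q code 0 a b

/-- The labels stored in the state. -/
noncomputable def storedLab (s : List Sym) (q code : ℕ) (b : ℕ) : ℕ :=
  ∑ v ∈ Finset.range q, ind (bit s q code 1 b v)

section Step

variable (Q : List Sym → ℕ) (act : List Sym → ℕ → ℕ → Prop) (adj : List Sym → ℕ → ℕ → ℕ → Prop)

/-- The update of a bit in one round of the auctions. -/
def nextBit (w s : List Sym) (code tag x y : ℕ) : Prop :=
  (tag = 0 ∧ nextMatch (Q w) (act w code) (adj w code) (storedMatch s (Q w) code)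
    (storedLab s (Q w) code) x y) ∨
  (tag = 1 ∧ (bit s (Q w) code 1 x y ∨ (Hit (Q w) (act w code) (adj w code)
    (storedMatch s (Q w) code) (storedLab s (Q w) code) x ∧ y ≤ storedLab s (Q w) code x)))

/-- The position `d.2` is read as a mixed-radix number, inverting `bitIndex`. -/
def auctionUpdate (d : Tapes × ℕ) : Prop :=
  nextBit Q act adj d.1.inp d.1.sta (d.2 / Q d.1.inp / Q d.1.inp / 2)
    (d.2 / Q d.1.inp / Q d.1.inp % 2) (d.2 / Q d.1.inp % Q d.1.inp) (d.2 % Q d.1.inp)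

variable {Q act adj} {α : Type} [Ctx α] {c t x y : α → ℕ}

theorem PTP.bit (hQ : PTInput Q) (hc : PT c) (ht : PT t) (hx : PT x) (hy : PT y) :
    PTP fun a => bit (Ctx.sta a) (Q (Ctx.inp a)) (c a) (t a) (x a) (y a) :=
  PTP.readAt_sta ((((((hc.mul (PT.const 2)).add ht).mul hQ).add hx).mul hQ).add hy) (some true)

theorem PT.storedLab (hQ : PTInput Q) (hc : PT c) (hx : PT x) :
    PT fun a => storedLab (Ctx.sta a) (Q (Ctx.inp a)) (c a) (x a) :=
  PT.sum hQ (PTP.bit (α := α × ℕ) hQ hc.weaken (PT.const 1) hx.weaken PT.var).ind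

theorem PTP.firstFree (hQ : PTInput Q) (hact : PTInput₂ act) (hc : PT c) (hx : PT x) :
    PTP fun a => FirstFree (Q (Ctx.inp a)) (act (Ctx.inp a) (c a))
      (storedMatch (Ctx.sta a) (Q (Ctx.inp a)) (c a)) (x a) :=
  (hact hc hx).and ((PTP.ex hQ (PTP.bit (α := α × ℕ) hQ hc.weaken PT.zero hx.weaken PT.var)).not.and
    (PTP.all hx ((hact (α := α × ℕ) hc.weaken PT.var).imp (PTP.ex (α := α × ℕ) hQ
      (PTP.bit (α := (α × ℕ) × ℕ) hQ hc.weaken.weaken PT.zero PT.var.weaken PT.var)))))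

theorem PTP.chosen (hQ : PTInput Q) (hact : PTInput₂ act) (hadj : PTInput₃ adj) (hc : PT c)
    (hx : PT x) (hy : PT y) :
    PTP fun a => Chosen (Q (Ctx.inp a)) (act (Ctx.inp a) (c a)) (adj (Ctx.inp a) (c a))
      (storedMatch (Ctx.sta a) (Q (Ctx.inp a)) (c a))
      (storedLab (Ctx.sta a) (Q (Ctx.inp a)) (c a)) (x a) (y a) :=
  (PTP.firstFree hQ hact hc hx).and ((hadj hc hx hy).and
    (PTP.all hQ ((hadj (α := α × ℕ) hc.weaken hx.weaken PT.var).imp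
      (PTP.le (((PT.storedLab hQ hc hy).mul hQ).add hy).weaken
        (((PT.storedLab (α := α × ℕ) hQ hc.weaken PT.var).mul hQ).add PT.var)))))

theorem PTP.hit (hQ : PTInput Q) (hact : PTInput₂ act) (hadj : PTInput₃ adj) (hc : PT c)
    (hy : PT y) :
    PTP fun a => Hit (Q (Ctx.inp a)) (act (Ctx.inp a) (c a)) (adj (Ctx.inp a) (c a))
      (storedMatch (Ctx.sta a) (Q (Ctx.inp a)) (c a))
      (storedLab (Ctx.sta a) (Q (Ctx.inp a)) (c a)) (y a) :=
  PTP.ex hQ (PTP.chosen (α := α × ℕ) hQ hact hadj hc.weaken PT.var hy.weaken)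

theorem PTP.nextBit (hQ : PTInput Q) (hact : PTInput₂ act) (hadj : PTInput₃ adj) (hc : PT c)
    (ht : PT t) (hx : PT x) (hy : PT y) :
    PTP fun a => nextBit Q act adj (Ctx.inp a) (Ctx.sta a) (c a) (t a) (x a) (y a) :=
  ((PTP.eq ht PT.zero).and ((PTP.chosen hQ hact hadj hc hx hy).or
      ((PTP.bit hQ hc PT.zero hx hy).and (PTP.hit hQ hact hadj hc hy).not))).or
    ((PTP.eq ht (PT.const 1)).and ((PTP.bit hQ hc (PT.const 1) hx hy).or
      ((PTP.hit hQ hact hadj hc hx).and (PTP.le hy (PT.storedLab hQ hc hx)))))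

theorem PTP.auctionUpdate (hQ : PTInput Q) (hpos : ∀ w, 0 < Q w) (hact : PTInput₂ act)
    (hadj : PTInput₃ adj) : PTP (auctionUpdate Q act adj) := by
  have hq : PT fun d : Tapes × ℕ => Q d.1.inp := hQ
  have h1 := (PT.var (α := Tapes)).div hq fun _ => hpos _
  have h2 := h1.div hq fun _ => hpos _
  exact PTP.nextBit hQ hact hadj (h2.div (PT.const 2) fun _ => two_pos)
    (h2.mod (PT.const 2) fun _ => two_pos) (h1.mod hq fun _ => hpos _)
    (PT.var.mod hq fun _ => hpos _)

end Step

/-! ### Mixed-radix positions of the bits -/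

section Decode

variable {q code tag x y : ℕ}

theorem mul_add_mod_of_lt {a b c : ℕ} (h : c < b) : (a * b + c) % b = c := by
  rw [Nat.mul_add_mod_self_right, Nat.mod_eq_of_lt h]

theorem mul_add_div_of_lt {a b c : ℕ} (h : c < b) : (a * b + c) / b = a := by
  rw [mul_comm, Nat.mul_add_div (by omega), Nat.div_eq_of_lt h, add_zero]

theorem bitIndex_mod (hy : y < q) : bitIndex q code tag x y % q = y := mul_add_mod_of_lt hy

theorem bitIndex_div (hy : y < q) : bitIndex q code tag x y / q = (code * 2 + tag) * q + x := by
  rw [bitIndex, mul_add_div_of_lt hy]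

theorem bitIndex_lt {n : ℕ} (hc : code < n) (ht : tag < 2) (hx : x < q) (hy : y < q) :
    bitIndex q code tag x y < n * 2 * q * q := by
  have h1 : code * 2 + tag + 1 ≤ n * 2 := by omega
  have h2 : (code * 2 + tag) * q + x + 1 ≤ n * 2 * q := by
    have := Nat.mul_le_mul_right q h1
    rw [Nat.succ_mul] at this
    omega
  have := Nat.mul_le_mul_right q h2
  rw [Nat.succ_mul] at this
  unfold bitIndex
  omega

end Decode

section Congr

variable {Q : ℕ} {act : ℕ → Prop} {adj : ℕ → ℕ → Prop} {M M' : ℕ → ℕ → Prop} {lab lab' : ℕ → ℕ}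

/-- The stored bits represent the matching and the labels only below `Q`; a round looks at nothing
else. -/
theorem chosen_congr (hM : ∀ a < Q, ∀ b < Q, (M a b ↔ M' a b)) (hl : ∀ b < Q, lab b = lab' b)
    {a b : ℕ} (ha : a < Q) (hb : b < Q) :
    Chosen Q act adj M lab a b ↔ Chosen Q act adj M' lab' a b := by
  have h : ∀ a < Q, (∃ b < Q, M a b) ↔ ∃ b < Q, M' a b := fun a ha =>
    exists_congr fun b => and_congr_right fun hb => hM a ha b hb
  refine and_congr (and_congr_right fun _ => and_congr (not_congr (h a ha)) ?_)
    (and_congr_right fun _ => ?_)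
  · exact forall_congr' fun a' => forall_congr' fun ha' => imp_congr_right fun _ =>
      h a' (ha'.trans ha)
  · exact forall_congr' fun b' => forall_congr' fun hb' => imp_congr_right fun _ => by
      rw [hl b hb, hl b' hb']

theorem hit_congr (hM : ∀ a < Q, ∀ b < Q, (M a b ↔ M' a b)) (hl : ∀ b < Q, lab b = lab' b)
    {b : ℕ} (hb : b < Q) : Hit Q act adj M lab b ↔ Hit Q act adj M' lab' b :=
  exists_congr fun _ => and_congr_right fun ha => chosen_congr hM hl ha hb

theorem nextMatch_congr (hM : ∀ a < Q, ∀ b < Q, (M a b ↔ M' a b)) (hl : ∀ b < Q, lab b = lab' b)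
    {a b : ℕ} (ha : a < Q) (hb : b < Q) :
    nextMatch Q act adj M lab a b ↔ nextMatch Q act adj M' lab' a b :=
  or_congr (chosen_congr hM hl ha hb)
    (and_congr (hM a ha b hb) (not_congr (hit_congr hM hl hb)))

end Congr

section Step

variable {Q : List Sym → ℕ} {act : List Sym → ℕ → ℕ → Prop} {adj : List Sym → ℕ → ℕ → ℕ → Prop}

/-- The length of the state. -/
def stateSize (Q codes : List Sym → ℕ) (w : List Sym) : ℕ := codes w * 2 * Q w * Q w

theorem bit_iterState_succ {codes : List Sym → ℕ} {w : List Sym} {t code tag x y : ℕ}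
    (hc : code < codes w) (ht : tag < 2) (hx : x < Q w) (hy : y < Q w) :
    bit (iterState (stateSize Q codes) (auctionUpdate Q act adj) w (t + 1)) (Q w) code tag x y ↔
      nextBit Q act adj w (iterState (stateSize Q codes) (auctionUpdate Q act adj) w t)
        code tag x y := by
  have hlt : bitIndex (Q w) code tag x y < stateSize Q codes w := bitIndex_lt hc ht hx hy
  unfold bit
  rw [iterState, List.getElem?_map, List.getElem?_range hlt]
  simp only [Option.map_some, Option.some.injEq, decide_eq_true_eq]
  simp only [auctionUpdate]
  rw [bitIndex_mod hy, bitIndex_div hy, mul_add_div_of_lt hx, mul_add_mod_of_lt hx,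
    mul_add_div_of_lt ht, mul_add_mod_of_lt ht]

/-- A label is stored in unary: bit `y` of vertex `x` says that `y` is below the label. A hit
therefore sets the bits `y ≤ lab x`, and the cut-off at `Q` is automatic, since only `Q` bits are
stored. -/
theorem bit_iterState {codes : List Sym → ℕ} {w : List Sym} {code : ℕ} (hc : code < codes w)
    (t : ℕ) :
    (∀ x < Q w, ∀ y < Q w,
      (storedMatch (iterState (stateSize Q codes) (auctionUpdate Q act adj) w t) (Q w) code x y ↔
        (auction (Q w) (act w code) (adj w code) t).1 x y)) ∧
    ∀ x < Q w, ∀ y < Q w,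
      (bit (iterState (stateSize Q codes) (auctionUpdate Q act adj) w t) (Q w) code 1 x y ↔
        y < (auction (Q w) (act w code) (adj w code) t).2 x) := by
  induction t with
  -- The initial state is the empty word; reading outside it yields no set bit, which means the
  -- empty matching and zero labels.
  | zero => simp [storedMatch, bit, iterState, auction]
  | succ t ih =>
    obtain ⟨ih1, ih2⟩ := ih
    have hl : ∀ x < Q w, storedLab (iterState (stateSize Q codes) (auctionUpdate Q act adj) w t)
        (Q w) code x = (auction (Q w) (act w code) (adj w code) t).2 x := by
      intro x hx
      unfold storedLab
      rw [Finset.sum_congr rfl fun y hy => ind_congr (ih2 x hx y (Finset.mem_range.1 hy)),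
        sum_ind_lt]
      exact min_eq_right ((auction_inv _ _ _ t).lab_le_size x hx)
    refine ⟨fun x hx y hy => ?_, fun x hx y hy => ?_⟩
    · rw [storedMatch, bit_iterState_succ hc two_pos hx hy, nextBit]
      simp only [true_and, zero_ne_one, false_and, or_false]
      exact nextMatch_congr ih1 hl hx hy
    · rw [bit_iterState_succ hc one_lt_two hx hy, nextBit]
      simp only [true_and, one_ne_zero, false_and, false_or]
      rw [ih2 x hx y hy, hit_congr ih1 hl hx, hl x hx]
      change _ ↔ y < nextLab _ _ _ _ _ _
      unfold nextLab
      split_ifs with h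
      · simp only [h, true_and]
        omega
      · simp [h]

/-- A problem that asks whether one of polynomially many bipartite graphs has a matching is
solvable in polynomial time. -/
theorem solvableInPolynomialTime_of_saturable {β : Type} {enc : β → List (Option Bool)}
    {L : β → Prop} {codes : List Sym → ℕ} (hQ : PTInput Q) (hpos : ∀ w, 0 < Q w)
    (hcodes : PTInput codes) (hact : PTInput₂ act) (hadj : PTInput₃ adj)
    (h : ∀ a, L a ↔ ∃ code < codes (enc a),
      Saturable (Q (enc a)) (act (enc a) code) (adj (enc a) code)) :
    SolvableInPolynomialTime enc L := by
  refine solvableInPolynomialTime_of_iterState (size := stateSize Q codes)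
    (rounds := fun w => Q w * Q w + 1) (φ := auctionUpdate Q act adj)
    (ψ := fun d => ∃ code < codes d.inp, ∀ a < Q d.inp, act d.inp code a →
      ∃ b < Q d.inp, bit d.sta (Q d.inp) code 0 a b) ?_ ?_
    (PTP.auctionUpdate hQ hpos hact hadj) ?_ fun a => ?_
  · exact ((PT.mul hcodes (PT.const 2)).mul hQ).mul hQ
  · exact (PT.mul hQ hQ).succ
  · exact PTP.ex (α := Tapes) hcodes (PTP.all (α := Tapes × ℕ) hQ
      ((hact (α := (Tapes × ℕ) × ℕ) PT.var.weaken PT.var).imp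
        (PTP.ex (α := (Tapes × ℕ) × ℕ) hQ (PTP.bit (α := ((Tapes × ℕ) × ℕ) × ℕ) hQ
          PT.var.weaken.weaken PT.zero PT.var.weaken PT.var))))
  · rw [h a]
    refine exists_congr fun code => and_congr_right fun hc => ?_
    rw [← allMatched_iff]
    refine forall_congr' fun x => forall_congr' fun hx => imp_congr_right fun _ =>
      exists_congr fun y => and_congr_right fun hy => ?_
    exact ((bit_iterState hc _).1 x hx y hy).symm

end Step

/-! ### Reading the input word -/

/-- The number of symbols between position `p` and the next end marker. -/
noncomputable def runLength (w : List Sym) (p : ℕ) : ℕ :=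
  ∑ j ∈ Finset.range w.length, ind (∀ i < j + 1, w[p + i]? ≠ some none)

noncomputable def numCand (w : List Sym) : ℕ := runLength w 0

noncomputable def favourite (w : List Sym) : ℕ := runLength w (numCand w + 1)

/-- The position of the first table. -/
noncomputable def tableStart (w : List Sym) : ℕ := numCand w + favourite w + 2

/-- Each table takes `m * m + 1` symbols; the subtracted one is the table of the tie breaker, which
is also why the voter index is shifted by one in `prefAt`. -/
noncomputable def numVoters (w : List Sym) : ℕ :=
  (w.length - tableStart w) / (numCand w * numCand w + 1) - 1

def tieAt (w : List Sym) (a b : ℕ) : Prop :=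
  w[tableStart w + (a * numCand w + b)]? = some (some true)

def prefAt (w : List Sym) (i a b : ℕ) : Prop :=
  w[tableStart w + ((i + 1) * (numCand w * numCand w + 1) + (a * numCand w + b))]? =
    some (some true)

section Reading

variable {α : Type} [Ctx α]

theorem PT.runLength {f : α → ℕ} (hf : PT f) : PT fun a => runLength (Ctx.inp a) (f a) :=
  PT.sum PT.length_inp (PTP.all (α := α × ℕ) PT.var.succ
    (PTP.readAt_inp (α := (α × ℕ) × ℕ) (hf.weaken.weaken.add PT.var) none).not).ind

theorem PT.numCand : PTInput numCand := PT.runLength PT.zero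

theorem PT.favourite : PTInput favourite := PT.runLength (PT.succ PT.numCand)

theorem PT.tableStart : PTInput tableStart := (PT.add PT.numCand PT.favourite).add (PT.const 2)

theorem PT.numVoters : PTInput numVoters :=
  ((PT.sub PT.length_inp PT.tableStart).div (PT.mul PT.numCand PT.numCand).succ
    fun _ => Nat.succ_pos _).sub (PT.const 1)

theorem PTP.tieAt {f g : α → ℕ} (hf : PT f) (hg : PT g) :
    PTP fun a => tieAt (Ctx.inp a) (f a) (g a) :=
  PTP.readAt_inp (PT.add PT.tableStart ((hf.mul PT.numCand).add hg)) (some true)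

theorem PTP.prefAt {f g h : α → ℕ} (hf : PT f) (hg : PT g) (hh : PT h) :
    PTP fun a => prefAt (Ctx.inp a) (f a) (g a) (h a) :=
  PTP.readAt_inp (PT.add PT.tableStart ((hf.succ.mul (PT.mul PT.numCand PT.numCand).succ).add
    ((hg.mul PT.numCand).add hh))) (some true)

end Reading

theorem getElem?_flatMap {β γ : Type} {f : β → List γ} {L : ℕ} (l : List β)
    (hL : ∀ b ∈ l, (f b).length = L) (i : ℕ) {j : ℕ} (hj : j < L) :
    (l.flatMap f)[i * L + j]? = l[i]?.bind fun b => (f b)[j]? := by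
  induction l generalizing i with
  | nil => simp
  | cons b l ih =>
    have hb : (f b).length = L := hL b (by simp)
    rw [List.flatMap_cons]
    cases i with
    | zero =>
      rw [zero_mul, zero_add, List.getElem?_append_left (by omega)]
      rfl
    | succ i =>
      rw [List.getElem?_append_right (by rw [hb, Nat.succ_mul]; omega), hb,
        show (i + 1) * L + j - L = i * L + j by rw [Nat.succ_mul]; omega,
        ih fun b hb => hL b (List.mem_cons_of_mem _ hb)]
      rfl

theorem length_encodeNat (a : ℕ) : (encodeNat a).length = a + 1 := by simp [encodeNat]

theorem length_encodeTable {m : ℕ} (R : Fin m → Fin m → Bool) :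
    (encodeTable R).length = m * m + 1 := by
  simp [encodeTable, List.length_flatMap]

theorem getElem?_encodeTable {m : ℕ} (R : Fin m → Fin m → Bool) (a b : Fin m) :
    (encodeTable R)[a.1 * m + b.1]? = some (some (R a b)) := by
  have hlt : a.1 * m + b.1 < m * m := by
    have := Nat.mul_le_mul_right m (Nat.succ_le_of_lt a.2)
    rw [Nat.succ_mul] at this
    omega
  rw [encodeTable, List.getElem?_append_left (by simpa [List.length_flatMap] using hlt),
    getElem?_flatMap _ (by simp) _ b.2]
  simp

/-- The first end marker after `u` is `a` places on, so the summand for `j` is the indicator of `j <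
a`. -/
theorem runLength_eq {u v : List Sym} {a : ℕ} :
    runLength (u ++ (encodeNat a ++ v)) u.length = a := by
  set w := u ++ (encodeNat a ++ v) with hw
  have hget : ∀ i, w[u.length + i]? = (encodeNat a ++ v)[i]? := fun i => by
    rw [hw, List.getElem?_append_right (by omega)]
    congr 1
    omega
  have h1 : ∀ i < a, w[u.length + i]? ≠ some none := fun i hi => by
    rw [hget, encodeNat, List.append_assoc, List.getElem?_append_left (by simpa using hi)]
    simp [hi]
  have h2 : w[u.length + a]? = some none := by
    rw [hget, encodeNat, List.append_assoc, List.getElem?_append_right (by simp)]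
    simp
  have h3 : ∀ j, (∀ i < j + 1, w[u.length + i]? ≠ some none) ↔ j < a := fun j => by
    constructor
    · intro h
      by_contra! hle
      exact h a (by omega) h2
    · intro h i hi
      exact h1 i (by omega)
  unfold runLength
  simp only [h3, sum_ind_lt]
  refine min_eq_right ?_
  simp [hw, length_encodeNat]
  omega

section Encode

variable (I : Input)

/-- The tables of the input. -/
def Input.tables : List (Fin I.m → Fin I.m → Bool) :=
  I.tie :: (List.finRange I.n).map I.profile

theorem Input.encode_eq : I.encode =
    encodeNat I.m ++ (encodeNat I.c ++ I.tables.flatMap encodeTable) := by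
  simp [Input.encode, Input.tables, List.flatMap_map]

theorem numCand_encode : numCand I.encode = I.m := by
  rw [Input.encode_eq]
  exact runLength_eq (u := [])

theorem favourite_encode : favourite I.encode = I.c := by
  rw [favourite, numCand_encode, Input.encode_eq, ← length_encodeNat]
  exact runLength_eq

theorem tableStart_encode : tableStart I.encode = I.m + I.c + 2 := by
  rw [tableStart, numCand_encode, favourite_encode]

theorem length_tables : (I.tables.flatMap encodeTable).length = (I.n + 1) * (I.m * I.m + 1) := by
  rw [List.length_flatMap, List.map_congr_left fun R _ => length_encodeTable R]
  simp [Input.tables, Nat.succ_mul, add_comm, Function.comp_def]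

theorem numVoters_encode : numVoters I.encode = I.n := by
  have h : I.encode.length - (I.m + I.c + 2) = (I.n + 1) * (I.m * I.m + 1) := by
    rw [Input.encode_eq, List.length_append, List.length_append, length_tables,
      length_encodeNat, length_encodeNat]
    omega
  rw [numVoters, numCand_encode, tableStart_encode, h, Nat.mul_div_cancel _ (Nat.succ_pos _)]
  rfl

theorem getElem?_encode (i : ℕ) (a b : Fin I.m) :
    I.encode[I.m + I.c + 2 + (i * (I.m * I.m + 1) + (a.1 * I.m + b.1))]? =
      I.tables[i]?.map fun R => some (R a b) := by
  have hlt : a.1 * I.m + b.1 < I.m * I.m + 1 := by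
    have := Nat.mul_le_mul_right I.m (Nat.succ_le_of_lt a.2)
    rw [Nat.succ_mul] at this
    omega
  rw [Input.encode_eq, List.getElem?_append_right (by rw [length_encodeNat]; omega),
    List.getElem?_append_right (by simp only [length_encodeNat]; omega), length_encodeNat,
    length_encodeNat, show I.m + I.c.1 + 2 + (i * (I.m * I.m + 1) + (a.1 * I.m + b.1)) - (I.m + 1) -
      (I.c.1 + 1) = i * (I.m * I.m + 1) + (a.1 * I.m + b.1) by omega,
    getElem?_flatMap _ (fun R _ => length_encodeTable R) i hlt]
  cases I.tables[i]? with
  | none => rfl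
  | some R => simp [getElem?_encodeTable]

theorem tieAt_encode (a b : Fin I.m) : tieAt I.encode a b ↔ I.tie a b = true := by
  have := getElem?_encode I 0 a b
  rw [zero_mul, zero_add] at this
  rw [tieAt, tableStart_encode, numCand_encode, this]
  simp [Input.tables]

theorem prefAt_encode (i : Fin I.n) (a b : Fin I.m) :
    prefAt I.encode i a b ↔ I.profile i a b = true := by
  rw [prefAt, tableStart_encode, numCand_encode, getElem?_encode I (i + 1) a b]
  simp [Input.tables]

end Encode

/-! ### Assignments of voters and matchings -/

open Classical in
theorem sum_ind_eq_card {β : Type} (s : Finset β) (p : β → Prop) :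
    ∑ i ∈ s, ind (p i) = (s.filter p).card := by
  simp [ind, Finset.sum_boole]

/-- The number of voters below `n` that `t` assigns to `b`. -/
noncomputable def load (n : ℕ) (t : ℕ → ℕ) (b : ℕ) : ℕ := ∑ i ∈ Finset.range n, ind (t i = b)

theorem load_eq_card (n : ℕ) (t : ℕ → ℕ) (b : ℕ) :
    load n t b = ((Finset.range n).filter fun i => t i = b).card := by
  classical
  rw [load, sum_ind_eq_card]
  congr

theorem load_le (n : ℕ) (t : ℕ → ℕ) (b : ℕ) : load n t b ≤ n := by
  rw [load_eq_card]
  exact (Finset.card_filter_le _ _).trans (by simp)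

/-- Thus `load a t (t a)`, the number of earlier voters with the same candidate, is a rank that
separates the voters of one candidate. -/
theorem load_strictMono {t : ℕ → ℕ} {a a' : ℕ} (h : a < a') :
    load a t (t a) < load a' t (t a) := by
  rw [load_eq_card, load_eq_card]
  refine Finset.card_lt_card ⟨fun i hi => ?_, fun hsub => ?_⟩
  · simp only [Finset.mem_filter, Finset.mem_range] at hi ⊢
    exact ⟨hi.1.trans h, hi.2⟩
  · have h1 : a ∈ (Finset.range a').filter fun i => t i = t a := by simp [h]
    simpa using hsub h1

section Saturable

variable {n m : ℕ} {E : ℕ → ℕ → Prop} {c : ℕ} {D τ : ℕ → Prop}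

/-- The active vertices for the plurality rule: the voters, and a vertex without neighbours for
each candidate that cannot be beaten. -/
def pluralityAct (n m c S : ℕ) (D τ : ℕ → Prop) (a : ℕ) : Prop :=
  a < n ∨ ∃ b < m, a = n + b ∧ b ≠ c ∧ ¬ D b ∧ τ b ∧ S = 0

/-- A voter may take a place of a candidate. -/
def pluralityAdj (n m c S : ℕ) (E : ℕ → ℕ → Prop) (D τ : ℕ → Prop) (a y : ℕ) : Prop :=
  a < n ∧ y / (n + 1) < m ∧ E a (y / (n + 1)) ∧ (y / (n + 1) = c ∨ D (y / (n + 1)) ∨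
    y % (n + 1) + 1 + ind (τ (y / (n + 1))) ≤ S)

theorem mul_add_lt {b j : ℕ} (hb : b < m) (hj : j < n + 1) :
    b * (n + 1) + j < (m + 1) * (n + 1) := by
  have := Nat.mul_le_mul_right (n + 1) (Nat.succ_le_of_lt hb)
  rw [Nat.succ_mul] at this
  rw [Nat.succ_mul m]
  omega

/-- Candidate `b` offers the places `b * (n + 1) + j`, and for a restricted rival only `S - ind (τ
b)` of them are open. This truncated difference misses the case `S = 0` with `τ b`, where even load
zero is too much; the isolated active vertex `n + b` makes matching impossible then. -/
theorem plurality_saturable_iff {S : ℕ} :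
    (∃ t : ℕ → ℕ, (∀ i < n, t i < m ∧ E i (t i)) ∧
      ∀ b < m, b ≠ c → ¬ D b → load n t b + ind (τ b) ≤ S) ↔
    Saturable ((m + 1) * (n + 1)) (pluralityAct n m c S D τ) (pluralityAdj n m c S E D τ) := by
  classical
  constructor
  · rintro ⟨t, ht, hS⟩
    have hact : ∀ a, pluralityAct n m c S D τ a → a < n := by
      rintro a (h | ⟨b, hb, -, hbc, hbD, hτ, hS0⟩)
      · exact h
      · have := hS b hb hbc hbD
        rw [ind_true hτ] at this
        omega
    have hlt : ∀ a, load a t (t a) < a + 1 := fun a => Nat.lt_succ_of_le (load_le a t _)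
    -- Each voter takes the place of its candidate whose number is its rank among the voters of that
    -- candidate.
    refine ⟨fun a => t a * (n + 1) + load a t (t a), fun a _ ha => ?_, fun a _ a' _ ha ha' e => ?_⟩
    · have han := hact a ha
      obtain ⟨h1, h2⟩ := ht a han
      have h3 : load a t (t a) < n + 1 := (hlt a).trans_le (by omega)
      refine ⟨mul_add_lt h1 h3, han, ?_⟩
      simp only [mul_add_div_of_lt h3, mul_add_mod_of_lt h3]
      refine ⟨h1, h2, ?_⟩
      by_cases hc : t a = c
      · exact Or.inl hc
      by_cases hD : D (t a)
      · exact Or.inr (Or.inl hD)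
      have h4 := hS _ h1 hc hD
      have h5 := load_strictMono (t := t) han
      exact Or.inr (Or.inr (by omega))
    · have han := hact a ha
      have han' := hact a' ha'
      have h3 : load a t (t a) < n + 1 := (hlt a).trans_le (by omega)
      have h3' : load a' t (t a') < n + 1 := (hlt a').trans_le (by omega)
      have e1 := congrArg (· / (n + 1)) e
      have e2 := congrArg (· % (n + 1)) e
      simp only [mul_add_div_of_lt h3, mul_add_mod_of_lt h3, mul_add_div_of_lt h3',
        mul_add_mod_of_lt h3'] at e1 e2
      rcases lt_trichotomy a a' with h | h | h
      · have := load_strictMono (t := t) h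
        rw [e1] at this e2
        omega
      · exact h
      · have := load_strictMono (t := t) h
        rw [← e1] at this e2
        omega
  · rintro ⟨μ, hμ, hinj⟩
    have hn : n ≤ (m + 1) * (n + 1) := by nlinarith
    have hadj := fun i (hi : i < n) => (hμ i (hi.trans_le hn) (Or.inl hi)).2
    refine ⟨fun i => μ i / (n + 1), fun i hi => ⟨(hadj i hi).2.1, (hadj i hi).2.2.1⟩,
      fun b hb hbc hbD => ?_⟩
    have hS : ind (τ b) ≤ S := by
      by_contra! hlt
      have hle := ind_le_one (τ b)
      have hτ : τ b := by
        by_contra hτ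
        rw [ind_false hτ] at hlt
        omega
      have := (hμ (n + b) (by nlinarith) (Or.inr ⟨b, hb, rfl, hbc, hbD, hτ, by omega⟩)).2.1
      omega
    -- Voters of the same candidate occupy distinct places, so their residues are distinct, and each
    -- is below `S - ind (τ b)`.
    have hcard : load n (fun i => μ i / (n + 1)) b ≤ (Finset.range (S - ind (τ b))).card := by
      rw [load_eq_card]
      refine Finset.card_le_card_of_injOn (fun i => μ i % (n + 1)) (fun i hi => ?_)
        fun i hi i' hi' e => ?_
      · obtain ⟨h1, h2⟩ := Finset.mem_filter.1 hi
        rw [Finset.mem_range] at h1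
        have h3 := (hadj i h1).2.2.2
        rw [h2] at h3
        refine Finset.mem_coe.2 (Finset.mem_range.2 ?_)
        rcases h3 with h3 | h3 | h3
        · exact absurd h3 hbc
        · exact absurd h3 hbD
        · dsimp only
          omega
      · obtain ⟨h1, h2⟩ := Finset.mem_filter.1 hi
        obtain ⟨h1', h2'⟩ := Finset.mem_filter.1 hi'
        rw [Finset.mem_range] at h1 h1'
        refine hinj i (h1.trans_le hn) i' (h1'.trans_le hn) (Or.inl h1) (Or.inl h1') ?_
        rw [← Nat.div_add_mod (μ i) (n + 1), ← Nat.div_add_mod (μ i') (n + 1), h2, h2']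
        exact congrArg _ e
    rw [Finset.card_range] at hcard
    omega

/-- The active vertices for the veto rule: the vetoes that candidates need. -/
def vetoAct (n m c V : ℕ) (D τ : ℕ → Prop) (x : ℕ) : Prop :=
  x / (n + 1) < m ∧ x / (n + 1) ≠ c ∧ ¬ D (x / (n + 1)) ∧
    x % (n + 1) < V + ind (τ (x / (n + 1)))

/-- A veto may come from a voter. -/
def vetoAdj (n : ℕ) (E : ℕ → ℕ → Prop) (x i : ℕ) : Prop := i < n ∧ E i (x / (n + 1))

theorem exists_enumeration (A : Finset ℕ) : ∃ e : ℕ → ℕ, (∀ j < A.card, e j ∈ A) ∧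
    ∀ j < A.card, ∀ j' < A.card, e j = e j' → j = j' := by
  refine ⟨fun j => if h : j < A.card then A.orderEmbOfFin rfl ⟨j, h⟩ else 0, fun j hj => ?_,
    fun j hj j' hj' e => ?_⟩
  · simp only [dif_pos hj]
    exact A.orderEmbOfFin_mem rfl _
  · simp only [dif_pos hj, dif_pos hj'] at e
    simpa using (A.orderEmbOfFin rfl).injective e

/-- Here the demands are the vertices to be covered: each restricted rival `b` asks for `V + ind (τ
b)` vetoes from distinct voters. `V ≤ n` makes this at most `n + 1`, so all demands have codes.
Unused voters veto any admissible candidate by `hE`; extra vetoes do not hurt lower bounds. -/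
theorem veto_saturable_iff {V : ℕ} (hV : V ≤ n) (hE : ∀ i < n, ∃ b < m, E i b) :
    (∃ t : ℕ → ℕ, (∀ i < n, t i < m ∧ E i (t i)) ∧
      ∀ b < m, b ≠ c → ¬ D b → V + ind (τ b) ≤ load n t b) ↔
    Saturable ((m + 1) * (n + 1)) (vetoAct n m c V D τ) (vetoAdj n E) := by
  classical
  constructor
  · rintro ⟨t, ht, hV⟩
    choose e he hinj using fun b => exists_enumeration ((Finset.range n).filter fun i => t i = b)
    simp only [← load_eq_card] at he hinj
    have hmem : ∀ x, vetoAct n m c V D τ x → x % (n + 1) < load n t (x / (n + 1)) ∧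
        e (x / (n + 1)) (x % (n + 1)) < n ∧ t (e (x / (n + 1)) (x % (n + 1))) = x / (n + 1) := by
      rintro x ⟨h1, h2, h3, h4⟩
      have h5 := h4.trans_le (hV _ h1 h2 h3)
      have h6 := Finset.mem_filter.1 (he _ _ h5)
      exact ⟨h5, Finset.mem_range.1 h6.1, h6.2⟩
    refine ⟨fun x => e (x / (n + 1)) (x % (n + 1)), fun x _ hx => ?_, fun x _ x' _ hx hx' heq => ?_⟩
    · obtain ⟨h1, h2, h3⟩ := hmem x hx
      have h4 := (ht _ h2).2
      rw [h3] at h4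
      exact ⟨h2.trans_le (by nlinarith), h2, h4⟩
    · obtain ⟨h1, h2, h3⟩ := hmem x hx
      obtain ⟨h1', h2', h3'⟩ := hmem x' hx'
      have hdiv : x / (n + 1) = x' / (n + 1) := by
        rw [← h3, ← h3']
        exact congrArg t heq
      simp only [hdiv] at heq h1
      have hmod := hinj _ _ h1 _ h1' heq
      rw [← Nat.div_add_mod x (n + 1), ← Nat.div_add_mod x' (n + 1), hdiv, hmod]
  · rintro ⟨μ, hμ, hinj⟩
    choose! d hd using hE
    -- A voter vetoes the candidate whose demand it serves, which is unambiguous by injectivity of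
    -- `μ`; the others use the default `d`.
    have hex : ∀ i < n, ∃ b < m, E i b ∧
        ∀ x < (m + 1) * (n + 1), vetoAct n m c V D τ x → μ x = i → b = x / (n + 1) := by
      intro i hi
      by_cases h : ∃ x < (m + 1) * (n + 1), vetoAct n m c V D τ x ∧ μ x = i
      · obtain ⟨x, hx, hact, rfl⟩ := h
        exact ⟨x / (n + 1), hact.1, (hμ x hx hact).2.2, fun x' hx' hact' e =>
          congrArg (· / (n + 1)) (hinj x hx x' hx' hact hact' e.symm)⟩
      · exact ⟨d i, (hd i hi).1, (hd i hi).2, fun x hx hact e => absurd ⟨x, hx, hact, e⟩ h⟩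
    choose! t htm htE htx using hex
    refine ⟨t, fun i hi => ⟨htm i hi, htE i hi⟩, fun b hb hbc hbD => ?_⟩
    have hle := ind_le_one (τ b)
    have hx : ∀ j < V + ind (τ b), b * (n + 1) + j < (m + 1) * (n + 1) ∧
        vetoAct n m c V D τ (b * (n + 1) + j) ∧ (b * (n + 1) + j) / (n + 1) = b := by
      intro j hj
      have hj' : j < n + 1 := by omega
      refine ⟨mul_add_lt hb hj', ?_, mul_add_div_of_lt hj'⟩
      simp only [vetoAct, mul_add_div_of_lt hj', mul_add_mod_of_lt hj']
      exact ⟨hb, hbc, hbD, hj⟩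
    rw [load_eq_card]
    calc V + ind (τ b) = (Finset.range (V + ind (τ b))).card := by simp
      _ ≤ _ := Finset.card_le_card_of_injOn (fun j => μ (b * (n + 1) + j)) (fun j hj => ?_)
        fun j hj j' hj' e => ?_
    · obtain ⟨h1, h2, h3⟩ := hx j (Finset.mem_range.1 hj)
      have h4 := (hμ _ h1 h2).2.1
      refine Finset.mem_coe.2 (Finset.mem_filter.2 ⟨Finset.mem_range.2 h4, ?_⟩)
      rw [htx _ h4 _ h1 h2 rfl, h3]
    · obtain ⟨h1, h2, h3⟩ := hx j (Finset.mem_range.1 hj)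
      obtain ⟨h1', h2', h3'⟩ := hx j' (Finset.mem_range.1 hj')
      have := hinj _ h1 _ h1' h2 h2' e
      omega

end Saturable

/-! ### Voting -/

section Orders

variable {C : Type}

/-- A strict partial order with a maximal element `x` has a linear extension with `x` on top. -/
theorem exists_extension_top (P : C → C → Prop) [IsStrictOrder C P] (x : C)
    (hx : ∀ a, ¬ P a x) :
    ∃ T : C → C → Prop, IsStrictTotalOrder C T ∧ (∀ a b, P a b → T a b) ∧ ∀ b, b ≠ x → T x b := by
  have hirr : ∀ a, ¬ P a a := irrefl_of P
  have htr : ∀ a b c, P a b → P b c → P a c := fun a b c => trans_of P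
  -- Placing `x` above everything creates no cycle, because nothing is above `x` in `P`. Any linear
  -- extension of `r` has `x` on top.
  let r : C → C → Prop := fun a b => a = b ∨ P a b ∨ a = x
  have hr : IsPartialOrder C r :=
    { refl := fun a => Or.inl rfl
      trans := by
        rintro a b c (rfl | h | rfl) (rfl | h' | rfl)
        · exact Or.inl rfl
        · exact Or.inr (Or.inl h')
        · exact Or.inr (Or.inr rfl)
        · exact Or.inr (Or.inl h)
        · exact Or.inr (Or.inl (htr _ _ _ h h'))
        · exact absurd h (hx a)
        · exact Or.inr (Or.inr rfl)
        · exact Or.inr (Or.inr rfl)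
        · exact Or.inr (Or.inr rfl)
      antisymm := by
        rintro a b (h | h | rfl) (h' | h' | rfl)
        · exact h
        · exact h
        · exact h
        · exact h'.symm
        · exact absurd (htr _ _ _ h h') (hirr a)
        · exact absurd h (hx a)
        · exact h'.symm
        · exact absurd h' (hx b)
        · rfl }
  obtain ⟨s, hs, hrs⟩ := extend_partialOrder r
  have hst : ∀ a b c, s a b → s b c → s a c := fun a b c => hs.trans a b c
  have hsa : ∀ a b, s a b → s b a → a = b := fun a b => hs.antisymm a b
  have htot : ∀ a b, s a b ∨ s b a := hs.total
  refine ⟨fun a b => s a b ∧ a ≠ b, ?_, fun a b h => ⟨hrs a b (Or.inr (Or.inl h)), ?_⟩,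
    fun b hb => ⟨hrs x b (Or.inr (Or.inr rfl)), hb.symm⟩⟩
  · exact
      { trichotomous := by
          intro a b h h'
          by_contra hne
          rcases htot a b with h1 | h1
          · exact h ⟨h1, hne⟩
          · exact h' ⟨h1, Ne.symm hne⟩
        irrefl := fun a h => h.2 rfl
        trans := by
          rintro a b c ⟨h1, h2⟩ ⟨h3, h4⟩
          refine ⟨hst _ _ _ h1 h3, ?_⟩
          rintro rfl
          exact h2 (hsa _ _ h1 h3) }
  · rintro rfl
    exact hirr a h

theorem exists_extension_bot (P : C → C → Prop) [IsStrictOrder C P] (x : C)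
    (hx : ∀ a, ¬ P x a) :
    ∃ T : C → C → Prop, IsStrictTotalOrder C T ∧ (∀ a b, P a b → T a b) ∧ ∀ b, b ≠ x → T b x := by
  have : IsStrictOrder C (Function.swap P) :=
    { irrefl := irrefl_of P, trans := fun a b c h h' => trans_of P h' h }
  obtain ⟨T, hT, h1, h2⟩ := exists_extension_top (Function.swap P) x hx
  refine ⟨Function.swap T, ?_, fun a b h => h1 b a h, h2⟩
  exact
    { trichotomous := fun a b h h' => hT.trichotomous a b h' h
      irrefl := hT.irrefl
      trans := fun a b c h h' => hT.trans c b a h' h }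

variable [Fintype C]

theorem exists_maximal_of_isStrictOrder (P : C → C → Prop) [IsStrictOrder C P] [Nonempty C] :
    ∃ x, ∀ a, ¬ P a x := by
  obtain ⟨x, -, hx⟩ := (Finite.wellFounded_of_trans_of_irrefl P).has_min Set.univ Set.univ_nonempty
  exact ⟨x, fun a => hx a trivial⟩

theorem exists_minimal_of_isStrictOrder (P : C → C → Prop) [IsStrictOrder C P] [Nonempty C] :
    ∃ x, ∀ a, ¬ P x a := by
  have : IsStrictOrder C (Function.swap P) :=
    { irrefl := irrefl_of P, trans := fun a b c h h' => trans_of P h' h }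
  exact exists_maximal_of_isStrictOrder (Function.swap P)

theorem position_eq_one_iff (T : C → C → Prop) (b : C) : position T b = 1 ↔ ∀ a, ¬ T a b := by
  rw [position, Nat.add_eq_right, Set.ncard_eq_zero (Set.toFinite _), Set.eq_empty_iff_forall_notMem]
  rfl

theorem position_eq_card_iff (T : C → C → Prop) [IsStrictTotalOrder C T] (b : C) :
    position T b = Nat.card C ↔ ∀ a, ¬ T b a := by
  have hsub : {a | T a b} ⊆ {b}ᶜ := by
    rintro a h rfl
    exact irrefl_of T a h
  have hcard : ({b}ᶜ : Set C).ncard + 1 = Nat.card C := by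
    have := Set.ncard_add_ncard_compl ({b} : Set C)
    rw [Set.ncard_singleton] at this
    omega
  rw [position, ← hcard, Nat.add_right_cancel_iff]
  constructor
  · intro h a hba
    have h1 := Set.eq_of_subset_of_ncard_le hsub h.ge
    have h2 : a ∈ ({b}ᶜ : Set C) := by
      rintro rfl
      exact irrefl_of T a hba
    rw [← h1] at h2
    exact asymm_of T hba h2
  · intro h
    congr 1
    refine Set.Subset.antisymm hsub fun a ha => ?_
    rcases trichotomous_of T a b with h1 | h1 | h1
    · exact h1
    · exact absurd h1 ha
    · exact absurd h1 (h a)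

end Orders

/-! ### Winning conditions in terms of the tops and bottoms of the ballots -/

section Winner

variable {C : Type} [Fintype C] {n : ℕ}

/-- Take for `D` the candidates ranked above `c`; conversely every such candidate lies in `D`.
Positions start at one, so `1 ≤ k` is necessary, and it must be stated since `k - 1` is truncated.
-/
theorem isTopKWinner_iff (r : PositionalScoringRule) (k : ℕ) (T : Fin n → C → C → Prop)
    (tie : C → C → Prop) [IsStrictTotalOrder C tie] (c : C) :
    IsTopKWinner r k T tie c ↔ 1 ≤ k ∧ ∃ D : Finset C, D.card ≤ k - 1 ∧
      ∀ b, b ≠ c → b ∉ D → totalScore r T b + ind (tie b c) ≤ totalScore r T c := by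
  classical
  have hout : ∀ b, ¬ outcome r T tie b c ↔
      totalScore r T b + ind (tie b c) ≤ totalScore r T c := by
    intro b
    unfold outcome
    by_cases h : tie b c
    · rw [ind_true h]
      simp only [h, and_true]
      omega
    · rw [ind_false h]
      simp only [h, and_false, or_false]
      omega
  rw [IsTopKWinner, position]
  constructor
  · intro h
    refine ⟨by omega, (Set.toFinite {b | outcome r T tie b c}).toFinset, ?_, fun b _ hb => ?_⟩
    · rw [← Set.ncard_eq_toFinset_card]
      omega
    · rw [← hout]
      simpa using hb
  · rintro ⟨hk, D, hD, h⟩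
    have hsub : {b | outcome r T tie b c} ⊆ (D : Set C) := by
      intro b hb
      by_contra hbD
      have hbc : b ≠ c := by
        rintro rfl
        rcases hb with h1 | h1
        · exact lt_irrefl _ h1
        · exact irrefl_of tie b h1.2
      exact (hout b).2 (h b hbc hbD) hb
    have := Set.ncard_le_ncard hsub (Set.toFinite _)
    rw [Set.ncard_coe_finset] at this
    omega

/-- The number of voters that `t` assigns to `b`. -/
noncomputable def count (t : Fin n → C) (b : C) : ℕ := ∑ i, ind (t i = b)

theorem totalScore_plurality (T : Fin n → C → C → Prop) [∀ i, IsStrictTotalOrder C (T i)]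
    (t : Fin n → C) (ht : ∀ i a, ¬ T i a (t i)) (b : C) :
    totalScore plurality T b = count t b := by
  classical
  refine Finset.sum_congr rfl fun i _ => ?_
  have : position (T i) b = 1 ↔ t i = b := by
    rw [position_eq_one_iff]
    constructor
    · intro h
      rcases trichotomous_of (T i) (t i) b with h1 | h1 | h1
      · exact absurd h1 (h _)
      · exact h1
      · exact absurd h1 (ht i b)
    · rintro rfl
      exact ht i
  simp [plurality, ind, this]

theorem totalScore_veto (T : Fin n → C → C → Prop) [∀ i, IsStrictTotalOrder C (T i)]
    (t : Fin n → C) (ht : ∀ i a, ¬ T i (t i) a) (b : C) :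
    totalScore veto T b + count t b = n := by
  classical
  rw [totalScore, count, ← Finset.sum_add_distrib]
  have : ∀ i, position (T i) b = Nat.card C ↔ t i = b := by
    intro i
    rw [position_eq_card_iff]
    constructor
    · intro h
      rcases trichotomous_of (T i) (t i) b with h1 | h1 | h1
      · exact absurd h1 (ht i b)
      · exact h1
      · exact absurd h1 (h _)
    · rintro rfl
      exact ht i
  have h1 : ∀ i ∈ Finset.univ, veto.score (Nat.card C) (position (T i) b) + ind (t i = b) = 1 := by
    intro i _
    simp only [veto, this]
    by_cases h : t i = b <;> simp [ind, h]
  rw [Finset.sum_congr rfl h1]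
  simp

theorem ind_mono {p q : Prop} (h : p → q) : ind p ≤ ind q := by
  by_cases hp : p
  · rw [ind_true hp, ind_true (h hp)]
  · rw [ind_false hp]
    exact Nat.zero_le _

variable (P : Fin n → C → C → Prop) [∀ i, IsStrictOrder C (P i)] (tie : C → C → Prop)
  [IsStrictTotalOrder C tie] (c : C) (k : ℕ)

/-- The score of `c` is at most the number of its potential supporters, and this is attained by
redirecting all of them to `c`, which only lowers the other counts. Hence `t` itself need not favour
`c`. -/
theorem isPossibleTopKWinner_plurality_iff :
    IsPossibleTopKWinner plurality k P tie c ↔ 1 ≤ k ∧ ∃ D : Finset C, D.card ≤ k - 1 ∧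
      ∃ t : Fin n → C, (∀ i a, ¬ P i a (t i)) ∧ ∀ b, b ≠ c → b ∉ D →
        count t b + ind (tie b c) ≤ ∑ i, ind (∀ a, ¬ P i a c) := by
  classical
  have : Nonempty C := ⟨c⟩
  constructor
  · rintro ⟨T, hT, hw⟩
    obtain ⟨hk, D, hD, h⟩ := (isTopKWinner_iff plurality k T tie c).1 hw
    have := fun i => (hT i).1
    choose t ht using fun i => exists_maximal_of_isStrictOrder (T i)
    have hP : ∀ i a, ¬ P i a (t i) := fun i a h => ht i a ((hT i).2 _ _ h)
    refine ⟨hk, D, hD, t, hP, fun b hbc hbD => ?_⟩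
    have h1 := h b hbc hbD
    rw [totalScore_plurality T t ht, totalScore_plurality T t ht] at h1
    refine h1.trans (Finset.sum_le_sum fun i _ => ind_mono ?_)
    rintro rfl
    exact hP i
  · rintro ⟨hk, D, hD, t, hP, h⟩
    set t' : Fin n → C := fun i => if ∀ a, ¬ P i a c then c else t i with ht'
    have hP' : ∀ i a, ¬ P i a (t' i) := by
      intro i a
      by_cases hc : ∀ a, ¬ P i a c
      · simp only [ht', if_pos hc]
        exact hc a
      · simp only [ht', if_neg hc]
        exact hP i a
    choose T hT hPT htop using fun i => exists_extension_top (P i) (t' i) (hP' i)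
    refine ⟨T, fun i => ⟨hT i, hPT i⟩, (isTopKWinner_iff plurality k T tie c).2
      ⟨hk, D, hD, fun b hbc hbD => ?_⟩⟩
    have htop' : ∀ i a, ¬ T i a (t' i) := by
      intro i a hTa
      by_cases hne : a = t' i
      · rw [hne] at hTa
        exact irrefl_of (T i) _ hTa
      · exact asymm_of (T i) hTa (htop i a hne)
    rw [totalScore_plurality T t' htop', totalScore_plurality T t' htop']
    have h1 : count t' b ≤ count t b := Finset.sum_le_sum fun i _ => ind_mono fun e => by
      by_cases hc : ∀ a, ¬ P i a c
      · simp only [ht', if_pos hc] at e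
        exact absurd e.symm hbc
      · simpa only [ht', if_neg hc] using e
    have h2 : ∑ i, ind (∀ a, ¬ P i a c) ≤ count t' c := Finset.sum_le_sum fun i _ =>
      ind_mono fun hc => if_pos hc
    exact (Nat.add_le_add_right h1 _).trans ((h b hbc hbD).trans h2)

/-- In terms of vetoes the comparison is reversed: a rival outside `D` needs at least as many vetoes
as `c`, and one more if it wins ties. The least number of vetoes for `c` is the number of voters
with no other minimal element. -/
theorem isPossibleTopKWinner_veto_iff :
    IsPossibleTopKWinner veto k P tie c ↔ 1 ≤ k ∧ ∃ D : Finset C, D.card ≤ k - 1 ∧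
      ∃ t : Fin n → C, (∀ i a, ¬ P i (t i) a) ∧ ∀ b, b ≠ c → b ∉ D →
        (∑ i, ind (∀ b, (∀ a, ¬ P i b a) → b = c)) + ind (tie b c) ≤ count t b := by
  classical
  have : Nonempty C := ⟨c⟩
  constructor
  · rintro ⟨T, hT, hw⟩
    obtain ⟨hk, D, hD, h⟩ := (isTopKWinner_iff veto k T tie c).1 hw
    have := fun i => (hT i).1
    choose t ht using fun i => exists_minimal_of_isStrictOrder (T i)
    have hP : ∀ i a, ¬ P i (t i) a := fun i a h => ht i a ((hT i).2 _ _ h)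
    refine ⟨hk, D, hD, t, hP, fun b hbc hbD => ?_⟩
    have h1 := h b hbc hbD
    have h2 := totalScore_veto T t ht b
    have h3 := totalScore_veto T t ht c
    have h4 : ∑ i, ind (∀ b, (∀ a, ¬ P i b a) → b = c) ≤ count t c :=
      Finset.sum_le_sum fun i _ => ind_mono fun h => h _ (hP i)
    omega
  · rintro ⟨hk, D, hD, t, hP, h⟩
    -- A veto against `c` is moved to another minimal element whenever there is one; all other
    -- vetoes stay, so no rival loses any.
    have hex : ∀ i, ∃ x, (∀ a, ¬ P i x a) ∧ (t i ≠ c → x = t i) ∧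
        (x = c → ∀ b, (∀ a, ¬ P i b a) → b = c) := by
      intro i
      by_cases hc : t i = c
      · by_cases hu : ∀ b, (∀ a, ¬ P i b a) → b = c
        · exact ⟨t i, hP i, fun _ => rfl, fun _ => hu⟩
        · push Not at hu
          obtain ⟨b, hb, hbc⟩ := hu
          exact ⟨b, hb, fun hne => absurd hc hne, fun e => absurd e hbc⟩
      · exact ⟨t i, hP i, fun _ => rfl, fun e => absurd e hc⟩
    choose t' hP' hkeep hforced using hex
    choose T hT hPT hbot using fun i => exists_extension_bot (P i) (t' i) (hP' i)
    refine ⟨T, fun i => ⟨hT i, hPT i⟩, (isTopKWinner_iff veto k T tie c).2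
      ⟨hk, D, hD, fun b hbc hbD => ?_⟩⟩
    have hbot' : ∀ i a, ¬ T i (t' i) a := by
      intro i a hTa
      by_cases hne : a = t' i
      · rw [hne] at hTa
        exact irrefl_of (T i) _ hTa
      · exact asymm_of (T i) hTa (hbot i a hne)
    have h1 : count t b ≤ count t' b := Finset.sum_le_sum fun i _ => ind_mono fun e => by
      rw [hkeep i (by rw [e]; exact hbc), e]
    have h2 : count t' c ≤ ∑ i, ind (∀ b, (∀ a, ¬ P i b a) → b = c) :=
      Finset.sum_le_sum fun i _ => ind_mono (hforced i)
    have h3 := totalScore_veto T t' hbot' b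
    have h4 := totalScore_veto T t' hbot' c
    have h5 := h b hbc hbD
    omega

end Winner

/-! ### Codes of small sets of candidates -/

/-- `b` is among the last `r` digits of `code`. -/
def inCode : ℕ → ℕ → ℕ → ℕ → Prop
  | 0, _, _, _ => False
  | r + 1, base, code, b => code % base = b ∨ inCode r base (code / base) b

/-- The elements of `D` become the digits. The coded set may be larger than `D`, since unused digits
still denote candidates; this is harmless, as enlarging the exempt set only weakens the
requirements. -/
theorem exists_code {base : ℕ} (hbase : 0 < base) (r : ℕ) : ∀ D : Finset ℕ, (∀ b ∈ D, b < base) →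
    D.card ≤ r → ∃ code < base ^ r, ∀ b ∈ D, inCode r base code b := by
  classical
  induction r with
  | zero =>
    intro D _ hcard
    rw [Nat.le_zero, Finset.card_eq_zero] at hcard
    subst hcard
    exact ⟨0, by simp, by simp⟩
  | succ r ih =>
    intro D hD hcard
    rcases D.eq_empty_or_nonempty with rfl | ⟨x, hx⟩
    · exact ⟨0, pow_pos hbase _, by simp⟩
    · obtain ⟨code, hcode, h⟩ := ih (D.erase x) (fun b hb => hD b (Finset.mem_of_mem_erase hb))
        (by rw [Finset.card_erase_of_mem hx]; omega)
      refine ⟨code * base + x, ?_, fun b hb => ?_⟩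
      · have h1 := Nat.mul_le_mul_right base (Nat.succ_le_of_lt hcode)
        have h2 := hD x hx
        rw [Nat.succ_mul] at h1
        rw [pow_succ]
        omega
      · rw [inCode, mul_add_mod_of_lt (hD x hx), mul_add_div_of_lt (hD x hx)]
        by_cases hbx : b = x
        · exact Or.inl hbx.symm
        · exact Or.inr (h b (Finset.mem_erase.2 ⟨hbx, hb⟩))

open Classical in
theorem card_inCode_le (base r : ℕ) (s : Finset ℕ) : ∀ code,
    (s.filter (inCode r base code)).card ≤ r := by
  induction r with
  | zero =>
    intro code
    rw [Nat.le_zero, Finset.card_eq_zero, Finset.filter_eq_empty_iff]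
    exact fun _ _ h => h
  | succ r ih =>
    intro code
    have hsub : s.filter (inCode (r + 1) base code) ⊆
        insert (code % base) (s.filter (inCode r base (code / base))) := by
      intro b hb
      obtain ⟨h1, h2⟩ := Finset.mem_filter.1 hb
      rcases h2 with h2 | h2
      · exact Finset.mem_insert.2 (Or.inl h2.symm)
      · exact Finset.mem_insert_of_mem (Finset.mem_filter.2 ⟨h1, h2⟩)
    exact (Finset.card_le_card hsub).trans ((Finset.card_insert_le _ _).trans
      (Nat.succ_le_succ (ih _)))

/-- Passage from sets and functions on `Fin` to codes and functions on `ℕ`, for both rules at once.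
A code yields at most `r` exempt candidates by `card_inCode_le`, whatever its digits are. -/
theorem exists_assignment_iff {m n : ℕ} (c : Fin m) (r : ℕ) (E R : ℕ → ℕ → Prop) :
    (∃ D : Finset (Fin m), D.card ≤ r ∧ ∃ t : Fin n → Fin m, (∀ i : Fin n, E i (t i)) ∧
      ∀ b, b ≠ c → b ∉ D → R b (count t b)) ↔
    ∃ code < (m + 1) ^ r, ∃ t : ℕ → ℕ, (∀ i < n, t i < m ∧ E i (t i)) ∧
      ∀ b < m, b ≠ c → ¬ inCode r (m + 1) code b → R b (load n t b) := by
  classical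
  constructor
  · rintro ⟨D, hD, t, hE, hR⟩
    obtain ⟨code, hcode, h⟩ := exists_code (Nat.succ_pos m) r (D.image Fin.val)
      (by simp only [Finset.mem_image]; rintro b ⟨b, -, rfl⟩; omega)
      (Finset.card_image_le.trans hD)
    refine ⟨code, hcode, fun i => if h : i < n then (t ⟨i, h⟩).1 else 0, fun i hi => ?_,
      fun b hb hbc hbD => ?_⟩
    · simp only [dif_pos hi]
      exact ⟨(t ⟨i, hi⟩).2, hE ⟨i, hi⟩⟩
    · have h1 := hR ⟨b, hb⟩ (fun e => hbc (congrArg Fin.val e))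
        (fun hmem => hbD (h b (Finset.mem_image_of_mem Fin.val hmem)))
      convert h1 using 1
      rw [load, count, ← Fin.sum_univ_eq_sum_range
        (fun i => ind ((if h : i < n then (t ⟨i, h⟩).1 else 0) = b)) n]
      refine Finset.sum_congr rfl fun i _ => ind_congr ?_
      simp [Fin.ext_iff]
  · rintro ⟨code, hcode, t, ht, hR⟩
    refine ⟨Finset.univ.filter fun b : Fin m => inCode r (m + 1) code b, ?_,
      fun i => ⟨t i, (ht i i.2).1⟩, fun i => (ht i i.2).2, fun b hbc hbD => ?_⟩
    · refine le_trans ?_ (card_inCode_le (m + 1) r (Finset.range m) code)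
      refine Finset.card_le_card_of_injOn Fin.val (fun b hb => ?_) Fin.val_injective.injOn
      have := (Finset.mem_filter.1 hb).2
      exact Finset.mem_coe.2 (Finset.mem_filter.2 ⟨Finset.mem_range.2 b.2, this⟩)
    · have h1 := hR b b.2 (fun e => hbc (Fin.ext e)) (by simpa using hbD)
      convert h1 using 1
      rw [load, count, ← Fin.sum_univ_eq_sum_range (fun i => ind (t i = b)) n]
      refine Finset.sum_congr rfl fun i _ => ind_congr ?_
      simp [Fin.ext_iff]

/-! ### The matching problems of the two rules -/

def maximalAt (w : List Sym) (i b : ℕ) : Prop := ∀ a < numCand w, ¬ prefAt w i a b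

def minimalAt (w : List Sym) (i b : ℕ) : Prop := ∀ a < numCand w, ¬ prefAt w i b a

/-- The number of voters who can rank the favourite first. -/
noncomputable def numSupporters (w : List Sym) : ℕ :=
  ∑ i ∈ Finset.range (numVoters w), ind (maximalAt w i (favourite w))

/-- The number of voters who must rank the favourite last. -/
noncomputable def numOpponents (w : List Sym) : ℕ :=
  ∑ i ∈ Finset.range (numVoters w), ind (∀ b < numCand w, minimalAt w i b → b = favourite w)

noncomputable def numVertices (w : List Sym) : ℕ := (numCand w + 1) * (numVoters w + 1)

/-- The number of codes of sets of fewer than `k` candidates. -/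
noncomputable def numCodes : ℕ → List Sym → ℕ
  | 0, _ => 0
  | r + 1, w => (numCand w + 1) ^ r

/-- Common shape of both rules: `F` is the activity predicate, and `S` is the fixed number,
supporters or opponents, with which the rivals are compared. -/
def rivalAct (F : ℕ → ℕ → ℕ → ℕ → (ℕ → Prop) → (ℕ → Prop) → ℕ → Prop) (S : List Sym → ℕ) (k : ℕ)
    (w : List Sym) (code : ℕ) : ℕ → Prop :=
  F (numVoters w) (numCand w) (favourite w) (S w) (inCode (k - 1) (numCand w + 1) code)
    fun b => tieAt w b (favourite w)

section PT

variable {α : Type} [Ctx α] {f g h : α → ℕ}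

theorem PTP.inCode (r : ℕ) (hf : PT f) (hg : PT g) :
    PTP fun a => inCode r (numCand (Ctx.inp a) + 1) (f a) (g a) := by
  induction r generalizing f with
  | zero => exact PTP.false
  | succ r ih =>
    have hb : PT fun a : α => numCand (Ctx.inp a) + 1 := PT.succ PT.numCand
    exact (PTP.eq (hf.mod hb fun _ => Nat.succ_pos _) hg).or
      (ih (hf.div hb fun _ => Nat.succ_pos _))

theorem PTP.maximalAt (hf : PT f) (hg : PT g) :
    PTP fun a => maximalAt (Ctx.inp a) (f a) (g a) :=
  PTP.all PT.numCand (PTP.prefAt (α := α × ℕ) hf.weaken PT.var hg.weaken).not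

theorem PTP.minimalAt (hf : PT f) (hg : PT g) :
    PTP fun a => minimalAt (Ctx.inp a) (f a) (g a) :=
  PTP.all PT.numCand (PTP.prefAt (α := α × ℕ) hf.weaken hg.weaken PT.var).not

theorem PT.numSupporters : PTInput numSupporters := fun {α} _ =>
  PT.sum PT.numVoters (PTP.maximalAt (α := α × ℕ) PT.var PT.favourite).ind

theorem PT.numOpponents : PTInput numOpponents := fun {α} _ =>
  PT.sum PT.numVoters (PTP.all (α := α × ℕ) PT.numCand
    ((PTP.minimalAt (α := (α × ℕ) × ℕ) PT.var.weaken PT.var).imp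
      (PTP.eq PT.var PT.favourite))).ind

theorem PT.numVertices : PTInput numVertices :=
  (PT.succ PT.numCand).mul (PT.succ PT.numVoters)

theorem PT.numCodes (k : ℕ) : PTInput (numCodes k) := by
  intro α _
  cases k with
  | zero => exact PT.zero
  | succ r => exact (PT.succ PT.numCand).pow r

theorem PTP.pluralityAct (k : ℕ) : PTInput₂ (rivalAct pluralityAct numSupporters k) :=
  fun {α} _ {_ _} hf hg =>
  (PTP.lt hg PT.numVoters).or (PTP.ex PT.numCand
    ((PTP.eq hg.weaken (PT.add (α := α × ℕ) PT.numVoters PT.var)).and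
      ((PTP.eq (α := α × ℕ) PT.var PT.favourite).not.and
        ((PTP.inCode (k - 1) hf.weaken PT.var).not.and
          ((PTP.tieAt (α := α × ℕ) PT.var PT.favourite).and
            (PTP.eq (α := α × ℕ) PT.numSupporters PT.zero))))))

theorem PTP.vetoAct (k : ℕ) : PTInput₂ (rivalAct vetoAct numOpponents k) :=
  fun {α} _ {_ _} hf hg => by
  have hn : PT fun a : α => numVoters (Ctx.inp a) + 1 := PT.succ PT.numVoters
  have hdiv := hg.div hn fun _ => Nat.succ_pos _
  have hmod := hg.mod hn fun _ => Nat.succ_pos _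
  exact (PTP.lt hdiv PT.numCand).and ((PTP.eq hdiv PT.favourite).not.and
    ((PTP.inCode (k - 1) hf hdiv).not.and
      (PTP.lt hmod (PT.add PT.numOpponents (PTP.tieAt hdiv PT.favourite).ind))))

/-- The edges for the plurality rule, as a function of the input word. -/
def pluralityEdge (k : ℕ) (w : List Sym) (code : ℕ) : ℕ → ℕ → Prop :=
  pluralityAdj (numVoters w) (numCand w) (favourite w) (numSupporters w) (maximalAt w)
    (TopKVoting.inCode (k - 1) (numCand w + 1) code) fun b => tieAt w b (favourite w)

/-- The edges for the veto rule, as a function of the input word. -/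
def vetoEdge (w : List Sym) (_ : ℕ) : ℕ → ℕ → Prop := vetoAdj (numVoters w) (minimalAt w)

theorem PTP.pluralityEdge (k : ℕ) : PTInput₃ (pluralityEdge k) :=
  fun {α} _ {_ _ _} hf hg hh => by
  have hn : PT fun a : α => numVoters (Ctx.inp a) + 1 := PT.succ PT.numVoters
  have hdiv := hh.div hn fun _ => Nat.succ_pos _
  have hmod := hh.mod hn fun _ => Nat.succ_pos _
  exact (PTP.lt hg PT.numVoters).and ((PTP.lt hdiv PT.numCand).and
    ((PTP.maximalAt hg hdiv).and ((PTP.eq hdiv PT.favourite).or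
      ((PTP.inCode (k - 1) hf hdiv).or
        (PTP.le (hmod.succ.add (PTP.tieAt hdiv PT.favourite).ind) PT.numSupporters)))))

theorem PTP.vetoEdge : PTInput₃ vetoEdge :=
  fun {α} _ {_ _ _} _ hg hh => by
  have hn : PT fun a : α => numVoters (Ctx.inp a) + 1 := PT.succ PT.numVoters
  exact (PTP.lt hh PT.numVoters).and
    (PTP.minimalAt hh (hg.div hn fun _ => Nat.succ_pos _))

end PT

section Main

variable (I : Input)

theorem maximalAt_encode (i : Fin I.n) (b : Fin I.m) :
    maximalAt I.encode i b ↔ ∀ a, ¬ I.profile i a b = true := by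
  unfold maximalAt
  rw [numCand_encode]
  refine ⟨fun h a => ?_, fun h a ha => ?_⟩
  · rw [← prefAt_encode]
    exact h a a.2
  · rw [show a = (⟨a, ha⟩ : Fin I.m).1 from rfl, prefAt_encode]
    exact h _

theorem minimalAt_encode (i : Fin I.n) (b : Fin I.m) :
    minimalAt I.encode i b ↔ ∀ a, ¬ I.profile i b a = true := by
  unfold minimalAt
  rw [numCand_encode]
  refine ⟨fun h a => ?_, fun h a ha => ?_⟩
  · rw [← prefAt_encode]
    exact h a a.2
  · rw [show a = (⟨a, ha⟩ : Fin I.m).1 from rfl, prefAt_encode]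
    exact h _

theorem numSupporters_encode :
    numSupporters I.encode = ∑ i, ind (∀ a, ¬ I.profile i a I.c = true) := by
  rw [numSupporters, numVoters_encode, favourite_encode,
    ← Fin.sum_univ_eq_sum_range (fun i => ind (maximalAt I.encode i I.c))]
  exact Finset.sum_congr rfl fun i _ => ind_congr (maximalAt_encode I i I.c)

theorem numOpponents_encode : numOpponents I.encode =
    ∑ i, ind (∀ b, (∀ a, ¬ I.profile i b a = true) → b = I.c) := by
  rw [numOpponents, numVoters_encode, favourite_encode, numCand_encode,
    ← Fin.sum_univ_eq_sum_range (fun i => ind (∀ b < I.m, minimalAt I.encode i b → b = I.c))]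
  refine Finset.sum_congr rfl fun i _ => ind_congr ⟨fun h b hb => ?_, fun h b hb hmin => ?_⟩
  · exact Fin.ext (h b b.2 ((minimalAt_encode I i b).2 hb))
  · exact congrArg Fin.val (h ⟨b, hb⟩ ((minimalAt_encode I i ⟨b, hb⟩).1 hmin))

theorem numOpponents_le (w : List Sym) : numOpponents w ≤ numVoters w := by
  simpa [numOpponents] using Finset.sum_le_card_nsmul (Finset.range (numVoters w))
    (fun i => ind (∀ b < numCand w, minimalAt w i b → b = favourite w)) 1
    fun i _ => ind_le_one _

theorem ptw_plurality_iff (k : ℕ) : PTW plurality k I ↔ ∃ code < numCodes k I.encode,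
    Saturable (numVertices I.encode) (rivalAct pluralityAct numSupporters k I.encode code)
      (pluralityEdge k I.encode code) := by
  have := I.profile_isStrictOrder
  have := I.tie_isStrictTotalOrder
  rw [PTW, isPossibleTopKWinner_plurality_iff]
  cases k with
  -- No position is at most zero, and accordingly there are no codes.
  | zero => simp [numCodes]
  | succ r =>
    simp only [numVertices, rivalAct, pluralityEdge, ← plurality_saturable_iff]
    rw [numVoters_encode, favourite_encode, numCand_encode, numSupporters_encode, numCodes,
      numCand_encode, Nat.add_sub_cancel, ← exists_assignment_iff I.c r (maximalAt I.encode)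
      (fun b x => x + ind (tieAt I.encode b I.c) ≤ ∑ i, ind (∀ a, ¬ I.profile i a I.c = true))]
    simp only [maximalAt_encode, tieAt_encode]
    simp

theorem ptw_veto_iff (k : ℕ) : PTW veto k I ↔ ∃ code < numCodes k I.encode,
    Saturable (numVertices I.encode) (rivalAct vetoAct numOpponents k I.encode code)
      (vetoEdge I.encode code) := by
  have := I.profile_isStrictOrder
  have := I.tie_isStrictTotalOrder
  have : Nonempty (Fin I.m) := ⟨I.c⟩
  -- Every voter has a minimal candidate, as the candidate set contains `I.c` and is finite; this is
  -- the default veto in the matching argument.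
  have hmin : ∀ i < numVoters I.encode, ∃ b < numCand I.encode, minimalAt I.encode i b := by
    rw [numVoters_encode, numCand_encode]
    intro i hi
    obtain ⟨b, hb⟩ := exists_minimal_of_isStrictOrder fun a b => I.profile ⟨i, hi⟩ a b = true
    exact ⟨b, b.2, (minimalAt_encode I ⟨i, hi⟩ b).2 hb⟩
  rw [PTW, isPossibleTopKWinner_veto_iff]
  cases k with
  | zero => simp [numCodes]
  | succ r =>
    simp only [numVertices, rivalAct, vetoEdge,
      ← veto_saturable_iff (numOpponents_le I.encode) hmin]
    rw [numVoters_encode, favourite_encode, numCand_encode, numOpponents_encode, numCodes,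
      numCand_encode, Nat.add_sub_cancel, ← exists_assignment_iff I.c r (minimalAt I.encode)
      (fun b x => (∑ i, ind (∀ b, (∀ a, ¬ I.profile i b a = true) → b = I.c)) +
        ind (tieAt I.encode b I.c) ≤ x)]
    simp only [minimalAt_encode, tieAt_encode]
    simp

end Main

end TopKVoting

theorem mainTheorem6 (k : ℕ) :
    TopKVoting.SolvableInPolynomialTime TopKVoting.Input.encode
        (TopKVoting.PTW TopKVoting.plurality k) ∧
      TopKVoting.SolvableInPolynomialTime TopKVoting.Input.encode
        (TopKVoting.PTW TopKVoting.veto k) := by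
  have hpos : ∀ w, 0 < TopKVoting.numVertices w := fun w =>
    Nat.mul_pos (Nat.succ_pos _) (Nat.succ_pos _)
  exact ⟨TopKVoting.solvableInPolynomialTime_of_saturable TopKVoting.PT.numVertices hpos
      (TopKVoting.PT.numCodes k) (TopKVoting.PTP.pluralityAct k) (TopKVoting.PTP.pluralityEdge k)
      fun I => TopKVoting.ptw_plurality_iff I k,
    TopKVoting.solvableInPolynomialTime_of_saturable TopKVoting.PT.numVertices hpos
      (TopKVoting.PT.numCodes k) (TopKVoting.PTP.vetoAct k) TopKVoting.PTP.vetoEdge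
      fun I => TopKVoting.ptw_veto_iff I k⟩
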